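/- Formulas are formulas of first-order logic (FO) with equality, over a vocabulary with countably many relation symbols of every arity $n\ge 1$ and countably many individual names (constants). Unary and binary relation symbols are also called concept names and role names. The signature $\mathrm{sig}(X)$ of an object $X$ is the set of relation symbols and individual names occurring in it. The guarded fragment GF is the set of FO formulas without constants that are built from atoms and equalities by the Boolean connectives and the guarded quantifiers $\exists\vec y\,(\alpha\wedge\varphi)$ and $\forall\vec y\,(\alpha\to\varphi)$, where $\alpha$ is an atom or an equality that contains all variables of $\vec y$ and all free variables of $\varphi$; $\mathrm{GF}^3$ is the set of GF formulas that use only three fixed variables. $\mathcal{ALC}$-concepts are given by $C,D ::= \top\mid\bot\mid A\mid\neg C\mid C\sqcap D\mid\exists r.C$, with $A$ a concept name and $r$ a role name, with the usual semantics. A set $\mathcal L_S$ of FO formulas contains $\mathcal{ALC}$ if every $\mathcal{ALC}$-concept $C$ is equivalent to some $\varphi(x)\in\mathcal L_S$ with exactly one free variable and $\mathrm{sig}(\varphi)\subseteq\mathrm{sig}(C)$. Let $\mathcal L$ be a set of FO formulas. A labeled $\mathcal L$-KB $(\mathcal K,P,N)$ with $\mathcal K=(\mathcal O,\mathcal D)$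 consists of a finite set $\mathcal O$ of sentences from $\mathcal L$, a finite set $\mathcal D$ of facts $R(a_1,\dots,a_n)$ with $R$ a relation symbol and $a_1,\dots,a_n$ individual names, such that all individual names in $\mathcal O$ occur in $\mathcal D$, and non-empty sets $P,N$ of individual names occurring in $\mathcal D$. Models of $\mathcal K$ are the structures satisfying $\mathcal O$ and $\mathcal D$ (distinct individual names may denote the same element), and $\mathcal K\models\varphi(a)$ means that $\varphi(a)$ holds in all models of $\mathcal K$. Let $\Sigma\subseteq\mathrm{sig}(\mathcal K)$ and let $\mathcal L_S$ be a set of FO formulas. $(\mathcal K,P,N)$ is non-projectively $\mathcal L_S(\Sigma)$-separable if there is $\varphi(x)\in\mathcal L_S$ with exactly one free variable such that $\mathrm{sig}(\varphi)\subseteq\Sigma$, $\mathcal K\models\varphi(a)$ for all $a\in P$, and $\mathcal K\not\models\varphi(a)$ for all $a\in N$. It is projectively $\mathcal L_S(\Sigma)$-separable if this holds with $\mathrm{sig}(\varphi)\subseteq\Sigma$ relaxed to $\mathrm{sig}(\varphi)\subseteq\Sigma\cup\Sigma_{\mathrm{help}}$ for some set $\Sigma_{\mathrm{help}}$ of concept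 names disjoint from $\mathrm{sig}(\mathcal K)$. (Projective) $(\mathcal L,\mathcal L_S)$-separability with signature is the problem to decide, given a labeled $\mathcal L$-KB $(\mathcal K,P,N)$ and a signature $\Sigma\subseteq\mathrm{sig}(\mathcal K)$, whether $(\mathcal K,P,N)$ is non-projectively (respectively, projectively) $\mathcal L_S(\Sigma)$-separable. **Theorem.** Let $\mathcal L$ and $\mathcal L_S$ be sets of FO formulas such that $\mathrm{GF}^3\subseteq\mathcal L$ and $\mathcal L_S$ contains $\mathcal{ALC}$. Then both projective and non-projective $(\mathcal L,\mathcal L_S)$-separability with signature are undecidable: in neither case is there an algorithm that terminates with the correct answer on every pair of a labeled $\mathcal L$-KB and a signature $\Sigma\subseteq\mathrm{sig}(\mathcal K)$. -/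

import Mathlib

/-! First-order logic with named variables, the three-variable guarded fragment, `ALC`,
and separability of labeled knowledge bases with signature. Named variables are used because
finite-variable fragments are about the re-use of variables. -/

namespace GFSep

/-! ## Syntax of first-order logic -/

/-- Terms: variables, and individual names (constants); each kind is indexed by `ℕ`. -/
inductive Term where
  | var (x : ℕ)
  | con (c : ℕ)

/-- First-order formulas with equality. For every arity there are countably many relation
symbols; `rel i [t₁, …, tₙ]` applies the `i`-th relation symbol of arity `n`. -/
inductive Fml where
  | eq (s t : Term)
  | rel (i : ℕ) (ts : List Term)
  | neg (φ : Fml)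
  | and (φ ψ : Fml)
  | ex (x : ℕ) (φ : Fml)

/-- Non-logical symbols: `rel i n` is the `i`-th relation symbol of arity `n` (unary ones are the
concept names, binary ones the role names), and `con c` is the `c`-th individual name. -/
inductive Symb where
  | rel (i n : ℕ)
  | con (c : ℕ)

/-- Variables occurring in a term. -/
def Term.vars : Term → Set ℕ
  | .var x => {x}
  | .con _ => ∅

/-- Symbols occurring in a term. -/
def Term.sig : Term → Set Symb
  | .var _ => ∅
  | .con c => {.con c}

namespace Fml

/-- Implication `φ → ψ`. -/
def imp (φ ψ : Fml) : Fml := neg (and φ (neg ψ))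

/-- Universal quantification `∀ x φ`. -/
def all (x : ℕ) (φ : Fml) : Fml := neg (ex x (neg φ))

/-- `∃ y₁ … ∃ yₖ φ`. -/
def exs (ys : List ℕ) (φ : Fml) : Fml := ys.foldr ex φ

/-- `∀ y₁ … ∀ yₖ φ`. -/
def alls (ys : List ℕ) (φ : Fml) : Fml := ys.foldr all φ

/-- Free variables. -/
def fv : Fml → Set ℕ
  | eq s t => s.vars ∪ t.vars
  | rel _ ts => {x | ∃ t ∈ ts, x ∈ t.vars}
  | neg φ => φ.fv
  | and φ ψ => φ.fv ∪ ψ.fv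
  | ex x φ => φ.fv \ {x}

/-- All variables, free or bound. -/
def vars : Fml → Set ℕ
  | eq s t => s.vars ∪ t.vars
  | rel _ ts => {x | ∃ t ∈ ts, x ∈ t.vars}
  | neg φ => φ.vars
  | and φ ψ => φ.vars ∪ ψ.vars
  | ex x φ => insert x φ.vars

/-- Signature: the relation symbols and individual names used in a formula. -/
def sig : Fml → Set Symb
  | eq s t => s.sig ∪ t.sig
  | rel i ts => insert (.rel i ts.length) {s | ∃ t ∈ ts, s ∈ t.sig}
  | neg φ => φ.sig
  | and φ ψ => φ.sig ∪ ψ.sig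
  | ex _ φ => φ.sig

end Fml

/-! ## The guarded fragment -/

/-- Atoms of the guarded fragment: equalities between variables and atoms `R(x₁, …, xₙ)`, `n ≥ 1`,
over variables. Constants are not admitted. -/
inductive GuardedAtom : Fml → Prop
  | eq (x y : ℕ) : GuardedAtom (.eq (.var x) (.var y))
  | rel (i : ℕ) (xs : List ℕ) (h : xs ≠ []) : GuardedAtom (.rel i (xs.map .var))

/-- The guarded fragment of first-order logic, with equality and without constants.
Quantification takes the forms `∃ ys (α ∧ φ)` and `∀ ys (α → φ)`, where the atom `α` contains
all variables in `ys` and all free variables of `φ`. -/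
inductive GF : Fml → Prop
  | atom {α : Fml} : GuardedAtom α → GF α
  | neg {φ : Fml} : GF φ → GF (.neg φ)
  | and {φ ψ : Fml} : GF φ → GF ψ → GF (.and φ ψ)
  | ex (ys : List ℕ) {α φ : Fml} : GuardedAtom α → GF φ → (∀ y ∈ ys, y ∈ α.fv) → φ.fv ⊆ α.fv →
      GF (.exs ys (.and α φ))
  | all (ys : List ℕ) {α φ : Fml} : GuardedAtom α → GF φ → (∀ y ∈ ys, y ∈ α.fv) → φ.fv ⊆ α.fv →
      GF (.alls ys (.imp α φ))

/-- The three-variable fragment of `GF`: guarded formulas in which no variables but three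
fixed ones occur. -/
def GF3 : Set Fml := {φ | GF φ ∧ φ.vars ⊆ {0, 1, 2}}

/-! ## Semantics -/

/-- Structures. `rel i [d₁, …, dₙ]` says that the tuple is in the extension of the `i`-th relation
symbol of arity `n`. The domain is non-empty, as it interprets the individual names. -/
structure Struc where
  /-- the domain -/
  Dom : Type
  /-- extensions of the relation symbols -/
  rel : ℕ → List Dom → Prop
  /-- interpretations of the individual names -/
  con : ℕ → Dom

/-- Value of a term under an assignment. -/
def Term.val (A : Struc) (ν : ℕ → A.Dom) : Term → A.Dom
  | .var x => ν x
  | .con c => A.con c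

/-- Satisfaction of a formula in a structure under an assignment. -/
def Fml.Sat (A : Struc) : (ℕ → A.Dom) → Fml → Prop
  | ν, .eq s t => s.val A ν = t.val A ν
  | ν, .rel i ts => A.rel i (ts.map (Term.val A ν))
  | ν, .neg φ => ¬ Fml.Sat A ν φ
  | ν, .and φ ψ => Fml.Sat A ν φ ∧ Fml.Sat A ν ψ
  | ν, .ex x φ => ∃ d : A.Dom, Fml.Sat A (Function.update ν x d) φ

/-! ## The description logic `ALC` -/

/-- `ALC`-concepts; `name A` is the `A`-th concept name and `ex r C` is `∃ r.C` for the
`r`-th role name. -/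
inductive ALC where
  | top
  | bot
  | name (A : ℕ)
  | neg (C : ALC)
  | inter (C D : ALC)
  | ex (r : ℕ) (C : ALC)

namespace ALC

/-- The extension of a concept in a structure. -/
def extn (A : Struc) : ALC → Set A.Dom
  | top => Set.univ
  | bot => ∅
  | name a => {d | A.rel a [d]}
  | neg C => (C.extn A)ᶜ
  | inter C D => C.extn A ∩ D.extn A
  | ex r C => {d | ∃ e, A.rel r [d, e] ∧ e ∈ C.extn A}

/-- The signature of a concept. -/
def sig : ALC → Set Symb
  | top => ∅
  | bot => ∅
  | name a => {.rel a 1}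
  | neg C => C.sig
  | inter C D => C.sig ∪ D.sig
  | ex r C => insert (.rel r 2) C.sig

end ALC

/-- The set `LS` of first-order formulas contains `ALC`: every `ALC`-concept is equivalent to
a formula in `LS` with a single free variable that uses no further symbols. -/
def ContainsALC (LS : Set Fml) : Prop :=
  ∀ C : ALC, ∃ φ ∈ LS, ∃ x : ℕ, φ.fv = {x} ∧ φ.sig ⊆ C.sig ∧
    ∀ (A : Struc) (ν : ℕ → A.Dom), φ.Sat A ν ↔ ν x ∈ C.extn A

/-! ## Labeled knowledge bases -/

/-- A fact `R(a₁, …, aₙ)`: the index of `R`, and the list of individual names. -/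
abbrev Fact := ℕ × List ℕ

/-- An input of the separability problem. Finite sets are presented by lists. -/
structure Input where
  /-- the ontology -/
  ont : List Fml
  /-- the database -/
  db : List Fact
  /-- the positive examples -/
  pos : List ℕ
  /-- the negative examples -/
  neg : List ℕ
  /-- the signature -/
  sgn : List Symb

namespace Input

/-- The individual names in the database. -/
def ind (I : Input) : Set ℕ := {c | ∃ f ∈ I.db, c ∈ f.2}

/-- The symbols used in the ontology. -/
def ontSig (I : Input) : Set Symb := {s | ∃ φ ∈ I.ont, s ∈ φ.sig}

/-- The symbols used in the database. -/
def dbSig (I : Input) : Set Symb :=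
  {s | ∃ f ∈ I.db, s = .rel f.1 f.2.length ∨ ∃ c ∈ f.2, s = .con c}

/-- The signature of the knowledge base. -/
def kbSig (I : Input) : Set Symb := I.ontSig ∪ I.dbSig

/-- `I` is a labeled `L`-knowledge base with a signature: the ontology consists of
`L`-sentences, the facts have positive arity, all individual names used in the ontology occur
in the database, positive and negative examples form non-empty sets of individual names of
the database, and the signature consists of symbols of the knowledge base. -/
structure IsLabeledKB (L : Set Fml) (I : Input) : Prop where
  ont_mem : ∀ φ ∈ I.ont, φ ∈ L
  ont_sentence : ∀ φ ∈ I.ont, φ.fv = ∅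
  db_arity : ∀ f ∈ I.db, f.2 ≠ []
  con_mem : ∀ c : ℕ, Symb.con c ∈ I.ontSig → c ∈ I.ind
  pos_ne : I.pos ≠ []
  neg_ne : I.neg ≠ []
  pos_mem : ∀ a ∈ I.pos, a ∈ I.ind
  neg_mem : ∀ a ∈ I.neg, a ∈ I.ind
  sgn_mem : ∀ s ∈ I.sgn, s ∈ I.kbSig

/-- `A` is a model of the knowledge base. -/
def IsModel (I : Input) (A : Struc) : Prop :=
  (∀ φ ∈ I.ont, ∀ ν : ℕ → A.Dom, φ.Sat A ν) ∧ ∀ f ∈ I.db, A.rel f.1 (f.2.map A.con)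

/-- `K ⊨ φ(a)`, for a formula `φ` with the single free variable `x`. -/
def Entails (I : Input) (φ : Fml) (x a : ℕ) : Prop :=
  ∀ A : Struc, I.IsModel A → ∀ ν : ℕ → A.Dom, ν x = A.con a → φ.Sat A ν

/-- `φ(x)` is entailed at all positive examples and at no negative example. -/
def Separates (I : Input) (φ : Fml) (x : ℕ) : Prop :=
  (∀ a ∈ I.pos, I.Entails φ x a) ∧ ∀ a ∈ I.neg, ¬ I.Entails φ x a

/-- Non-projective separability: some `φ(x)` in `LS` over the signature separates. -/
def NonProjSeparable (LS : Set Fml) (I : Input) : Prop :=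
  ∃ φ ∈ LS, ∃ x : ℕ, φ.fv = {x} ∧ φ.sig ⊆ {s | s ∈ I.sgn} ∧ I.Separates φ x

/-- Projective separability: in addition, `φ(x)` may use a set `H` of concept names that
do not occur in the knowledge base. -/
def ProjSeparable (LS : Set Fml) (I : Input) : Prop :=
  ∃ φ ∈ LS, ∃ x : ℕ, φ.fv = {x} ∧
    (∃ H : Set Symb, (∀ s ∈ H, ∃ i, s = .rel i 1) ∧ Disjoint H I.kbSig ∧
      φ.sig ⊆ {s | s ∈ I.sgn} ∪ H) ∧
    I.Separates φ x

end Input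

/-! ## Effective codings of the inputs -/

/-- Terms as a disjoint union. -/
def Term.equivSum : Term ≃ ℕ ⊕ ℕ where
  toFun
    | .var x => .inl x
    | .con c => .inr c
  invFun
    | .inl x => .var x
    | .inr c => .con c
  left_inv t := by cases t <;> rfl
  right_inv t := by cases t <;> rfl

instance : Denumerable Term := Denumerable.ofEquiv (ℕ ⊕ ℕ) Term.equivSum

/-- Symbols as a disjoint union. -/
def Symb.equivSum : Symb ≃ (ℕ × ℕ) ⊕ ℕ where
  toFun
    | .rel i n => .inl (i, n)
    | .con c => .inr c
  invFun
    | .inl p => .rel p.1 p.2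
    | .inr c => .con c
  left_inv s := by cases s <;> rfl
  right_inv s := by rcases s with ⟨i, n⟩ | c <;> rfl

instance : Denumerable Symb := Denumerable.ofEquiv ((ℕ × ℕ) ⊕ ℕ) Symb.equivSum

namespace Fml

/-- Gödel number of a formula. -/
def toNat : Fml → ℕ
  | eq s t => 5 * Encodable.encode (s, t)
  | rel i ts => 5 * Encodable.encode (i, ts) + 1
  | neg φ => 5 * φ.toNat + 2
  | and φ ψ => 5 * Nat.pair φ.toNat ψ.toNat + 3
  | ex x φ => 5 * Nat.pair x φ.toNat + 4

/-- The formula with a given Gödel number. -/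
def ofNat (n : ℕ) : Fml :=
  if h0 : n % 5 = 0 then
    eq (Denumerable.ofNat (Term × Term) (n / 5)).1 (Denumerable.ofNat (Term × Term) (n / 5)).2
  else if n % 5 = 1 then
    rel (Denumerable.ofNat (ℕ × List Term) (n / 5)).1
      (Denumerable.ofNat (ℕ × List Term) (n / 5)).2
  else if n % 5 = 2 then neg (ofNat (n / 5))
  else if n % 5 = 3 then and (ofNat (n / 5).unpair.1) (ofNat (n / 5).unpair.2)
  else ex (n / 5).unpair.1 (ofNat (n / 5).unpair.2)
  termination_by n
  decreasing_by
    all_goals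
      have h1 := Nat.unpair_left_le (n / 5)
      have h2 := Nat.unpair_right_le (n / 5)
      omega

theorem ofNat_toNat (φ : Fml) : ofNat φ.toNat = φ := by
  induction φ with
  | eq s t =>
    rw [ofNat, toNat, dif_pos (by omega), Nat.mul_div_cancel_left _ (by norm_num),
      Denumerable.ofNat_encode]
  | rel i ts =>
    rw [ofNat, toNat, dif_neg (by omega), if_pos (by omega),
      show ∀ m : ℕ, (5 * m + 1) / 5 = m by omega, Denumerable.ofNat_encode]
  | neg φ ih =>
    rw [ofNat, toNat, dif_neg (by omega), if_neg (by omega), if_pos (by omega),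
      show ∀ m : ℕ, (5 * m + 2) / 5 = m by omega, ih]
  | and φ ψ ih1 ih2 =>
    rw [ofNat, toNat, dif_neg (by omega), if_neg (by omega), if_neg (by omega),
      if_pos (by omega), show ∀ m : ℕ, (5 * m + 3) / 5 = m by omega, Nat.unpair_pair, ih1, ih2]
  | ex x φ ih =>
    rw [ofNat, toNat, dif_neg (by omega), if_neg (by omega), if_neg (by omega),
      if_neg (by omega), show ∀ m : ℕ, (5 * m + 4) / 5 = m by omega, Nat.unpair_pair, ih]

theorem toNat_ofNat (n : ℕ) : (ofNat n).toNat = n := by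
  induction n using Nat.strong_induction_on with
  | _ n ih =>
    have h1 := Nat.unpair_left_le (n / 5)
    have h2 := Nat.unpair_right_le (n / 5)
    rw [ofNat]
    split_ifs with a b c d
    · rw [toNat, Prod.mk.eta, Denumerable.encode_ofNat]; omega
    · rw [toNat, Prod.mk.eta, Denumerable.encode_ofNat]; omega
    · rw [toNat, ih _ (by omega)]; omega
    · rw [toNat, ih _ (by omega), ih _ (by omega), Nat.pair_unpair]; omega
    · rw [toNat, ih _ (by omega), Nat.pair_unpair]; omega

/-- The Gödel numbering as a bijection. -/
def equivNat : Fml ≃ ℕ := ⟨toNat, ofNat, ofNat_toNat, toNat_ofNat⟩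

end Fml

instance : Denumerable Fml := Denumerable.mk' Fml.equivNat

/-- Inputs as tuples. -/
def Input.equivProd : Input ≃ List Fml × List Fact × List ℕ × List ℕ × List Symb where
  toFun I := (I.ont, I.db, I.pos, I.neg, I.sgn)
  invFun p := ⟨p.1, p.2.1, p.2.2.1, p.2.2.2.1, p.2.2.2.2⟩
  left_inv _ := rfl
  right_inv _ := rfl

instance : Primcodable Input := Primcodable.ofEquiv _ Input.equivProd

/-! ## Decision problems -/

/-- A decision problem with admissible inputs `adm` and question `Q` is decidable if some algorithm
terminates on every admissible input with the correct answer. Nothing is required on other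
inputs. -/
def DecidableOn {α : Type} [Primcodable α] (adm Q : α → Prop) : Prop :=
  ∃ f : α →. Bool, Partrec f ∧ ∀ a, adm a → ∃ b ∈ f a, (b = true ↔ Q a)

/-- Projective `(L, LS)`-separability with signature is decidable. -/
def ProjSeparabilityDecidable (L LS : Set Fml) : Prop :=
  DecidableOn (Input.IsLabeledKB L) (Input.ProjSeparable LS)

/-- Non-projective `(L, LS)`-separability with signature is decidable. -/
def NonProjSeparabilityDecidable (L LS : Set Fml) : Prop :=
  DecidableOn (Input.IsLabeledKB L) (Input.NonProjSeparable LS)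

end GFSep

/-!
The halting problem is reduced to separability by way of queue machines: finite automata that append
letters to a queue and remove letters from its front.

The knowledge base of a queue machine (`machineInput`) places two heads, a read head and a write
head, at the positive example. The letters are role names, and they make up the signature; for each
state there is a binary relation symbol outside the signature that holds of the positions of the two
heads. The queue content is the word that is spelled by a path from the read head to the write head.
To append a letter `a`, the write head moves along an `a`-edge, if it sees edges for the letter `a`
only; to remove a letter, the read head moves along an edge. Three variables suffice, as a rule
mentions the two heads and the new position of one of them. The halting state is forbidden. Nothing
is said about the negative example.

* If the machine halts, let `w` be the word that it appends during the run. If all paths from the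
  positive example spelled `w`, then the heads would be forced to follow the run into the forbidden
  state (`exists_word_of_halts`). So the negation of the `ALC`-concept `wordC w` is entailed at the
  positive example. It is not entailed at the negative example, from which a path may spell `w`.
* If the machine does not halt, then any model can be changed outside the signature such that the
  positive example becomes the element named by the negative one (`isModel_runStruc`): the machine
  is in a state with heads at `d` and `e` if it reaches this state with a queue content spelled by a
  path from `d` to `e`. A write head that does not see exactly the letter to be written has no
  duties, so no assumption on the model is needed. Hence every formula over the signature and
  further concept names that is entailed at the positive example is entailed at the negative one.

Queue machines are universal, since they can simulate the stack machine that Mathlib provides for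
partial recursive functions: the queue holds the four stacks in cyclic order, and is rotated until
the required stack is in front (`QState.respects_simulates`). The machine is fixed, apart from some
states that write the input, so the reduction is computable.
-/

namespace GFSep

open StateTransition

/-! ### Queue machines -/

/-- Instructions of a queue machine with states `Q` and letters `A`: append a letter to the queue,
remove the first letter of the queue and branch on it, or halt. -/
inductive Instr (Q A : Type) where
  | write (a : A) (q : Q)
  | read (δ : A → Q)
  | halt

section Queue

variable {Q A : Type}

/-- One step of the queue machine with program `prog`; a configuration is a state with the content
of the queue. Machines that halt or read from the empty queue have no next configuration. -/
def qstep (prog : Q → Instr Q A) : Q × List A → Option (Q × List A)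
  | (q, l) => match prog q, l with
    | .write a q', l => some (q', l ++ [a])
    | .read δ, a :: l => some (δ a, l)
    | .read _, [] => none
    | .halt, _ => none

theorem qstep_write {prog : Q → Instr Q A} {q q' : Q} {a : A} (h : prog q = .write a q')
    (l : List A) : qstep prog (q, l) = some (q', l ++ [a]) := by
  simp [qstep, h]

theorem qstep_read {prog : Q → Instr Q A} {q : Q} {δ : A → Q} (h : prog q = .read δ)
    (a : A) (l : List A) : qstep prog (q, a :: l) = some (δ a, l) := by
  simp [qstep, h]

theorem qstep_halt {prog : Q → Instr Q A} {q : Q} (h : prog q = .halt) (l : List A) :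
    qstep prog (q, l) = none := by
  simp [qstep, h]

theorem prog_eq_halt_of_qstep_eq_none {prog : Q → Instr Q A} {q : Q} {l : List A}
    (hl : ∀ δ, prog q = .read δ → l ≠ []) (h : qstep prog (q, l) = none) : prog q = .halt := by
  cases hq : prog q with
  | write a q' => simp [qstep_write hq] at h
  | read δ =>
    cases l with
    | nil => exact absurd rfl (hl δ hq)
    | cons a l => simp [qstep_read hq] at h
  | halt => rfl

end Queue

/-! ### The ontology of a queue machine -/

section Formulas

variable {A : Type} [Fintype A]

/-- The index of the role name that stands for a letter. -/
noncomputable def role (a : A) : ℕ := Fintype.equivFin A a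

theorem role_lt (a : A) : role a < Fintype.card A := (Fintype.equivFin A a).isLt

theorem role_injective : Function.Injective (role : A → ℕ) :=
  Fin.val_injective.comp (Fintype.equivFin A).injective

/-- The atom saying that there is an `a`-edge from the variable `x` to the variable `y`. -/
noncomputable def edgeF (a : A) (x y : ℕ) : Fml := .rel (role a) [.var x, .var y]

variable (A) in
/-- The atom saying that the machine is in the `i`-th state with read head at `x` and write head
at `y`. The binary relation symbols with index below the number of letters are the role names of the
letters, so those of the states come after them. -/
def stateF (i x y : ℕ) : Fml := .rel (Fintype.card A + i) [.var x, .var y]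

/-- The ternary atom that serves as the guard for the new position of a head. -/
def moveF : Fml := .rel 0 [.var 0, .var 1, .var 2]

/-- The variable `x` has an outgoing `a`-edge, in guarded form. -/
noncomputable def hasEdgeF (a : A) (x : ℕ) : Fml := .exs [2] (.and (edgeF a x 2) (edgeF a x 2))

open scoped Classical in
/-- The letters other than `a`. -/
noncomputable def otherLetters (a : A) : List A := (Finset.univ.erase a).toList

theorem mem_otherLetters {a b : A} : b ∈ otherLetters a ↔ b ≠ a := by
  simp [otherLetters]

/-- The variable `x` has outgoing `a`-edges, and no outgoing edges for other letters. -/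
noncomputable def exactF (a : A) (x : ℕ) : Fml :=
  (otherLetters a).foldr (fun b φ => .and (.neg (hasEdgeF b x)) φ) (hasEdgeF a x)

/-- In state `i`, if the write head sees exactly the letter `a`, then it moves along an `a`-edge,
and the new state is `j`. -/
noncomputable def writeF (i : ℕ) (a : A) (j : ℕ) : Fml :=
  .alls [0, 1] (.imp (stateF A i 0 1) (.imp (exactF a 1)
    (.exs [2] (.and moveF (.and (edgeF a 1 2) (stateF A j 0 2))))))

/-- In state `i`, if the read head sees the letter `a`, then it moves along an `a`-edge, and the new
state is `j`. -/
noncomputable def readF (i : ℕ) (a : A) (j : ℕ) : Fml :=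
  .alls [0, 1] (.imp (stateF A i 0 1) (.imp (hasEdgeF a 0)
    (.exs [2] (.and moveF (.and (edgeF a 0 2) (stateF A j 2 1))))))

variable (A) in
/-- The `i`-th state does not occur. -/
def haltF (i : ℕ) : Fml := .alls [0, 1] (.imp (stateF A i 0 1) (.neg (stateF A i 0 1)))

/-- The sentences for an instruction of the state `q`, where `code` enumerates the states. -/
noncomputable def instrF {Q : Type} (code : Q → ℕ) (q : Q) : Instr Q A → List Fml
  | .write a q' => [writeF (code q) a (code q')]
  | .read δ => Finset.univ.toList.map fun a => readF (code q) a (code (δ a))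
  | .halt => [haltF A (code q)]

end Formulas

/-! ### Syntactic properties of the ontology -/

section Guarded

variable {A : Type} [Fintype A]

theorem guardedAtom_edgeF (a : A) (x y : ℕ) : GuardedAtom (edgeF a x y) :=
  .rel _ [x, y] (by simp)

theorem guardedAtom_stateF (i x y : ℕ) : GuardedAtom (stateF A i x y) :=
  .rel _ [x, y] (by simp)

theorem guardedAtom_moveF : GuardedAtom moveF := .rel 0 [0, 1, 2] (by simp)

theorem fv_edgeF (a : A) (x y : ℕ) : (edgeF a x y).fv = {x, y} := by
  ext; simp [edgeF, Fml.fv, Term.vars]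

theorem fv_stateF (i x y : ℕ) : (stateF A i x y).fv = {x, y} := by
  ext; simp [stateF, Fml.fv, Term.vars]

theorem fv_moveF : moveF.fv = {0, 1, 2} := by
  ext; simp [moveF, Fml.fv, Term.vars]

theorem fv_imp (φ ψ : Fml) : (Fml.imp φ ψ).fv = φ.fv ∪ ψ.fv := rfl

theorem vars_imp (φ ψ : Fml) : (Fml.imp φ ψ).vars = φ.vars ∪ ψ.vars := rfl

theorem sig_imp (φ ψ : Fml) : (Fml.imp φ ψ).sig = φ.sig ∪ ψ.sig := rfl

theorem fv_hasEdgeF (a : A) {x : ℕ} (hx : x ≠ 2) : (hasEdgeF a x).fv = {x} := by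
  ext y
  simp [hasEdgeF, Fml.exs, Fml.fv, fv_edgeF]
  grind

theorem fv_exactF (a : A) {x : ℕ} (hx : x ≠ 2) : (exactF a x).fv = {x} := by
  unfold exactF
  induction otherLetters a with
  | nil => exact fv_hasEdgeF a hx
  | cons b l ih => simp [Fml.fv, fv_hasEdgeF b hx, ih]

theorem gf_hasEdgeF (a : A) (x : ℕ) : GF (hasEdgeF a x) :=
  .ex [2] (guardedAtom_edgeF a x 2) (.atom (guardedAtom_edgeF a x 2)) (by simp [fv_edgeF])
    subset_rfl

theorem gf_exactF (a : A) (x : ℕ) : GF (exactF a x) := by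
  unfold exactF
  induction otherLetters a with
  | nil => exact gf_hasEdgeF a x
  | cons b l ih => exact .and (.neg (gf_hasEdgeF b x)) ih

theorem GF.imp {φ ψ : Fml} (hφ : GF φ) (hψ : GF ψ) : GF (.imp φ ψ) := .neg (.and hφ (.neg hψ))

theorem gf_writeF (i : ℕ) (a : A) (j : ℕ) : GF (writeF i a j) := by
  refine .all [0, 1] (guardedAtom_stateF i 0 1) ((gf_exactF a 1).imp (.ex [2] guardedAtom_moveF
    (.and (.atom (guardedAtom_edgeF a 1 2)) (.atom (guardedAtom_stateF j 0 2))) ?_ ?_)) ?_ ?_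
  · simp [fv_moveF]
  · intro x; simp [Fml.fv, fv_edgeF, fv_stateF, fv_moveF]
  · simp [fv_stateF]
  · intro x
    simp [fv_imp, Fml.exs, Fml.fv, fv_edgeF, fv_stateF, fv_moveF, fv_exactF]
    grind

theorem gf_readF (i : ℕ) (a : A) (j : ℕ) : GF (readF i a j) := by
  refine .all [0, 1] (guardedAtom_stateF i 0 1) ((gf_hasEdgeF a 0).imp (.ex [2] guardedAtom_moveF
    (.and (.atom (guardedAtom_edgeF a 0 2)) (.atom (guardedAtom_stateF j 2 1))) ?_ ?_)) ?_ ?_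
  · simp [fv_moveF]
  · intro x; simp [Fml.fv, fv_edgeF, fv_stateF, fv_moveF]; grind
  · simp [fv_stateF]
  · intro x
    simp [fv_imp, Fml.exs, Fml.fv, fv_edgeF, fv_stateF, fv_moveF, fv_hasEdgeF]
    grind

theorem gf_haltF (i : ℕ) : GF (haltF A i) :=
  .all [0, 1] (guardedAtom_stateF i 0 1) (.neg (.atom (guardedAtom_stateF i 0 1)))
    (by simp [fv_stateF]) subset_rfl

theorem vars_hasEdgeF (a : A) {x : ℕ} (hx : x ≤ 2) : (hasEdgeF a x).vars ⊆ {0, 1, 2} := by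
  intro y
  simp [hasEdgeF, edgeF, Fml.exs, Fml.vars, Term.vars]
  grind

theorem vars_exactF (a : A) {x : ℕ} (hx : x ≤ 2) : (exactF a x).vars ⊆ {0, 1, 2} := by
  unfold exactF
  induction otherLetters a with
  | nil => exact vars_hasEdgeF a hx
  | cons b l ih => exact Set.union_subset (vars_hasEdgeF b hx) ih

theorem vars_writeF (i : ℕ) (a : A) (j : ℕ) : (writeF i a j).vars ⊆ {0, 1, 2} := by
  intro y
  have := @vars_exactF _ _ a 1 (by norm_num) y
  simp [writeF, moveF, stateF, edgeF, Fml.exs, Fml.alls, Fml.all, vars_imp, Fml.vars, Term.vars]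
    at this ⊢
  grind

theorem vars_readF (i : ℕ) (a : A) (j : ℕ) : (readF i a j).vars ⊆ {0, 1, 2} := by
  intro y
  have := @vars_hasEdgeF _ _ a 0 (by norm_num) y
  simp [readF, moveF, stateF, edgeF, Fml.exs, Fml.alls, Fml.all, vars_imp, Fml.vars, Term.vars]
    at this ⊢
  grind

theorem vars_haltF (i : ℕ) : (haltF A i).vars ⊆ {0, 1, 2} := by
  intro y
  simp [haltF, stateF, Fml.alls, Fml.all, vars_imp, Fml.vars, Term.vars]
  grind

theorem fv_writeF (i : ℕ) (a : A) (j : ℕ) : (writeF i a j).fv = ∅ := by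
  ext y
  simp [writeF, fv_edgeF, fv_stateF, fv_moveF, Fml.exs, Fml.alls, Fml.all, fv_imp, Fml.fv,
    fv_exactF]
  grind

theorem fv_readF (i : ℕ) (a : A) (j : ℕ) : (readF i a j).fv = ∅ := by
  ext y
  simp [readF, fv_edgeF, fv_stateF, fv_moveF, Fml.exs, Fml.alls, Fml.all, fv_imp, Fml.fv,
    fv_hasEdgeF]
  grind

theorem fv_haltF (i : ℕ) : (haltF A i).fv = ∅ := by
  ext y
  simp [haltF, fv_stateF, Fml.alls, Fml.all, fv_imp, Fml.fv]

theorem con_notMem_sig_exactF (c : ℕ) (a : A) (x : ℕ) : Symb.con c ∉ (exactF a x).sig := by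
  unfold exactF
  induction otherLetters a with
  | nil => simp [hasEdgeF, edgeF, Fml.exs, Fml.sig, Term.sig]
  | cons b l ih =>
    simp [Fml.sig, ih]
    simp [hasEdgeF, edgeF, Fml.exs, Fml.sig, Term.sig]

theorem role_mem_sig_exactF (a b : A) (x : ℕ) : Symb.rel (role b) 2 ∈ (exactF a x).sig := by
  have key : b = a ∨ b ∈ otherLetters a := by simp [mem_otherLetters, em]
  unfold exactF
  generalize otherLetters a = l at key ⊢
  induction l with
  | nil =>
    obtain rfl : b = a := by simpa using key
    simp [hasEdgeF, edgeF, Fml.exs, Fml.sig]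
  | cons d l ih =>
    rcases (show d = b ∨ (b = a ∨ b ∈ l) by simp at key; tauto) with rfl | h
    · exact .inl (by simp [hasEdgeF, edgeF, Fml.exs, Fml.sig])
    · exact .inr (ih h)

theorem con_notMem_sig_writeF (c i : ℕ) (a : A) (j : ℕ) : Symb.con c ∉ (writeF i a j).sig := by
  simp [writeF, moveF, stateF, edgeF, Fml.exs, Fml.alls, Fml.all, sig_imp, Fml.sig, Term.sig,
    con_notMem_sig_exactF]

theorem con_notMem_sig_readF (c i : ℕ) (a : A) (j : ℕ) : Symb.con c ∉ (readF i a j).sig := by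
  simp [readF, hasEdgeF, moveF, stateF, edgeF, Fml.exs, Fml.alls, Fml.all, sig_imp, Fml.sig,
    Term.sig]

theorem con_notMem_sig_haltF (c i : ℕ) : Symb.con c ∉ (haltF A i).sig := by
  simp [haltF, stateF, Fml.alls, Fml.all, sig_imp, Fml.sig, Term.sig]

theorem role_mem_sig_writeF (b : A) (i : ℕ) (a : A) (j : ℕ) :
    Symb.rel (role b) 2 ∈ (writeF i a j).sig := by
  simp [writeF, Fml.alls, Fml.all, sig_imp, Fml.sig, role_mem_sig_exactF]

variable {Q : Type}

theorem mem_instrF {code : Q → ℕ} {q : Q} {i : Instr Q A} {φ : Fml} (h : φ ∈ instrF code q i) :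
    (∃ a q', i = .write a q' ∧ φ = writeF (code q) a (code q')) ∨
      (∃ δ a, i = .read δ ∧ φ = readF (code q) a (code (δ a))) ∨
      (i = .halt ∧ φ = haltF A (code q)) := by
  cases i with
  | write a q' => exact .inl ⟨a, q', rfl, by simpa [instrF] using h⟩
  | read δ =>
    obtain ⟨a, -, rfl⟩ := List.mem_map.1 h
    exact .inr (.inl ⟨δ, a, rfl, rfl⟩)
  | halt => exact .inr (.inr ⟨rfl, by simpa [instrF] using h⟩)

theorem instrF_spec {code : Q → ℕ} {q : Q} {i : Instr Q A} {φ : Fml} (h : φ ∈ instrF code q i) :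
    φ ∈ GF3 ∧ φ.fv = ∅ ∧ ∀ c, Symb.con c ∉ φ.sig := by
  rcases mem_instrF h with ⟨a, q', -, rfl⟩ | ⟨δ, a, -, rfl⟩ | ⟨-, rfl⟩
  · exact ⟨⟨gf_writeF _ _ _, vars_writeF _ _ _⟩, fv_writeF _ _ _, (con_notMem_sig_writeF · _ _ _)⟩
  · exact ⟨⟨gf_readF _ _ _, vars_readF _ _ _⟩, fv_readF _ _ _, (con_notMem_sig_readF · _ _ _)⟩
  · exact ⟨⟨gf_haltF _, vars_haltF _⟩, fv_haltF _, (con_notMem_sig_haltF · _)⟩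

end Guarded

/-! ### The meaning of the ontology -/

section Semantics

variable {A : Type} [Fintype A]

/-- The element `d` has outgoing `a`-edges, and no outgoing edges for other letters. -/
def Exact (S : Struc) (a : A) (d : S.Dom) : Prop :=
  (∃ z, S.rel (role a) [d, z]) ∧ ∀ b : A, b ≠ a → ¬ ∃ z, S.rel (role b) [d, z]

theorem sat_hasEdgeF (S : Struc) (ν : ℕ → S.Dom) (a : A) {x : ℕ} (hx : x ≠ 2) :
    (hasEdgeF a x).Sat S ν ↔ ∃ z, S.rel (role a) [ν x, z] := by
  simp [hasEdgeF, edgeF, Fml.exs, Fml.Sat, Term.val, hx]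

theorem sat_exactF (S : Struc) (ν : ℕ → S.Dom) (a : A) {x : ℕ} (hx : x ≠ 2) :
    (exactF a x).Sat S ν ↔ Exact S a (ν x) := by
  have key : (exactF a x).Sat S ν ↔ (∃ z, S.rel (role a) [ν x, z]) ∧
      ∀ b ∈ otherLetters a, ¬ ∃ z, S.rel (role b) [ν x, z] := by
    unfold exactF
    induction otherLetters a with
    | nil => simp [sat_hasEdgeF S ν a hx]
    | cons b l ih =>
      simp only [List.foldr_cons, Fml.Sat, sat_hasEdgeF S ν b hx, ih, List.forall_mem_cons]
      tauto
  simpa [Exact, mem_otherLetters] using key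

theorem sat_writeF (S : Struc) (i : ℕ) (a : A) (j : ℕ) :
    (∀ ν : ℕ → S.Dom, (writeF i a j).Sat S ν) ↔
      ∀ d e, S.rel (Fintype.card A + i) [d, e] → Exact S a e →
        ∃ z, S.rel 0 [d, e, z] ∧ S.rel (role a) [e, z] ∧ S.rel (Fintype.card A + j) [d, z] := by
  have : Nonempty S.Dom := ⟨S.con 0⟩
  simp [writeF, Fml.alls, Fml.all, Fml.imp, Fml.Sat, sat_exactF, Fml.exs, moveF, edgeF, stateF,
    Term.val]

theorem sat_readF (S : Struc) (i : ℕ) (a : A) (j : ℕ) :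
    (∀ ν : ℕ → S.Dom, (readF i a j).Sat S ν) ↔
      ∀ d e, S.rel (Fintype.card A + i) [d, e] → (∃ z, S.rel (role a) [d, z]) →
        ∃ z, S.rel 0 [d, e, z] ∧ S.rel (role a) [d, z] ∧ S.rel (Fintype.card A + j) [z, e] := by
  have : Nonempty S.Dom := ⟨S.con 0⟩
  simp [readF, Fml.alls, Fml.all, Fml.imp, Fml.Sat, sat_hasEdgeF, Fml.exs, moveF, edgeF, stateF,
    Term.val]

theorem sat_haltF (S : Struc) (i : ℕ) :
    (∀ ν : ℕ → S.Dom, (haltF A i).Sat S ν) ↔ ∀ d e, ¬ S.rel (Fintype.card A + i) [d, e] := by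
  have : Nonempty S.Dom := ⟨S.con 0⟩
  simp [haltF, Fml.alls, Fml.all, Fml.imp, Fml.Sat, stateF, Term.val]

end Semantics

/-! ### The knowledge base of a queue machine -/

section Machine

variable {Q A : Type} [Fintype A]

/-- The labeled knowledge base of a queue machine with program `prog`, initial state `q₀` and states
`X`, numbered by `code`. The name `0` is the positive example: both heads start there. The name `1`
is the negative example, about which nothing is said but that it occurs in the database. The
signature consists of the role names of the letters. -/
noncomputable def machineInput (prog : Q → Instr Q A) (code : Q → ℕ) (q₀ : Q)
    (X : List Q) : Input where
  ont := X.flatMap fun q => instrF code q (prog q)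
  db := [(Fintype.card A + code q₀, [0, 0]), (0, [1, 1, 1])]
  pos := [0]
  neg := [1]
  sgn := Finset.univ.toList.map fun a : A => .rel (role a) 2

variable {prog : Q → Instr Q A} {code : Q → ℕ} {q₀ : Q} {X : List Q}

theorem isLabeledKB_machineInput {L : Set Fml} (hL : GF3 ⊆ L)
    (hw : ∃ q ∈ X, ∃ a q', prog q = .write a q') :
    (machineInput prog code q₀ X).IsLabeledKB L where
  ont_mem φ h := by
    obtain ⟨q, -, h⟩ := List.mem_flatMap.1 h
    exact hL (instrF_spec h).1
  ont_sentence φ h := by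
    obtain ⟨q, -, h⟩ := List.mem_flatMap.1 h
    exact (instrF_spec h).2.1
  db_arity := by simp [machineInput]
  con_mem := by
    rintro c ⟨φ, h, hc⟩
    obtain ⟨q, -, h⟩ := List.mem_flatMap.1 h
    exact absurd hc ((instrF_spec h).2.2 c)
  pos_ne := by simp [machineInput]
  neg_ne := by simp [machineInput]
  pos_mem := by simp [machineInput, Input.ind]
  neg_mem := by simp [machineInput, Input.ind]
  sgn_mem := by
    intro s hs
    obtain ⟨b, -, rfl⟩ := List.mem_map.1 hs
    obtain ⟨q, hq, a, q', h⟩ := hw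
    exact .inl ⟨_, List.mem_flatMap.2 ⟨q, hq, by rw [h]; exact List.mem_singleton_self _⟩,
      role_mem_sig_writeF b _ _ _⟩

theorem isModel_machineInput (S : Struc) : (machineInput prog code q₀ X).IsModel S ↔
    (∀ q ∈ X, ∀ a q', prog q = .write a q' →
      ∀ d e, S.rel (Fintype.card A + code q) [d, e] → Exact S a e →
        ∃ z, S.rel 0 [d, e, z] ∧ S.rel (role a) [e, z] ∧
          S.rel (Fintype.card A + code q') [d, z]) ∧
    (∀ q ∈ X, ∀ δ, prog q = .read δ → ∀ a,
      ∀ d e, S.rel (Fintype.card A + code q) [d, e] → (∃ z, S.rel (role a) [d, z]) →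
        ∃ z, S.rel 0 [d, e, z] ∧ S.rel (role a) [d, z] ∧
          S.rel (Fintype.card A + code (δ a)) [z, e]) ∧
    (∀ q ∈ X, prog q = .halt → ∀ d e, ¬ S.rel (Fintype.card A + code q) [d, e]) ∧
    S.rel (Fintype.card A + code q₀) [S.con 0, S.con 0] ∧
    S.rel 0 [S.con 1, S.con 1, S.con 1] := by
  constructor
  · rintro ⟨ho, hd⟩
    replace ho : ∀ q ∈ X, ∀ φ ∈ instrF code q (prog q), ∀ ν : ℕ → S.Dom, φ.Sat S ν :=
      fun q hq φ hφ => ho φ (List.mem_flatMap.2 ⟨q, hq, hφ⟩)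
    refine ⟨fun q hq a q' h => ?_, fun q hq δ h a => ?_, fun q hq h => ?_, ?_, ?_⟩
    · exact (sat_writeF S _ a _).1 (ho q hq _ (by simp [h, instrF]))
    · refine (sat_readF S _ a _).1 (ho q hq _ ?_)
      rw [h]
      exact List.mem_map.2 ⟨a, by simp, rfl⟩
    · exact (sat_haltF S _).1 (ho q hq _ (by simp [h, instrF]))
    · exact hd (Fintype.card A + code q₀, [0, 0]) (by simp [machineInput])
    · exact hd (0, [1, 1, 1]) (by simp [machineInput])
  · rintro ⟨hw, hr, hh, h0, h1⟩
    refine ⟨fun φ hφ => ?_, ?_⟩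
    · obtain ⟨q, hq, hφ⟩ := List.mem_flatMap.1 hφ
      rcases mem_instrF hφ with ⟨a, q', h, rfl⟩ | ⟨δ, a, h, rfl⟩ | ⟨h, rfl⟩
      · exact (sat_writeF S _ a _).2 (hw q hq a q' h)
      · exact (sat_readF S _ a _).2 (hr q hq δ h a)
      · exact (sat_haltF S _).2 (hh q hq h)
    · simpa [machineInput] using ⟨h0, h1⟩

/-! ### Halting machines yield separating concepts -/

/-- The concept of the elements with outgoing `a`-edges but no outgoing edges for other letters. -/
noncomputable def exactC (a : A) : ALC :=
  (otherLetters a).foldr (fun b C => .inter (.neg (.ex (role b) .top)) C) (.ex (role a) .top)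

/-- The concept of the elements all of whose paths spell the word `w`: a path with at most as many
edges as `w` has letters spells a prefix of `w`, and can be prolonged until it spells `w`. -/
noncomputable def wordC : List A → ALC
  | [] => .top
  | a :: w => .inter (exactC a) (.neg (.ex (role a) (.neg (wordC w))))

theorem mem_extn_exactC (S : Struc) (a : A) (d : S.Dom) :
    d ∈ (exactC a).extn S ↔ Exact S a d := by
  have key : d ∈ (exactC a).extn S ↔ (∃ z, S.rel (role a) [d, z]) ∧
      ∀ b ∈ otherLetters a, ¬ ∃ z, S.rel (role b) [d, z] := by
    unfold exactC
    induction otherLetters a with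
    | nil => simp [ALC.extn]
    | cons b l ih =>
      simp only [List.foldr_cons, ALC.extn, Set.mem_inter_iff, ih, List.forall_mem_cons]
      simp
      tauto
  simpa [Exact, mem_otherLetters] using key

theorem mem_extn_wordC_cons (S : Struc) (a : A) (w : List A) (d : S.Dom) :
    d ∈ (wordC (a :: w)).extn S ↔
      Exact S a d ∧ ∀ z, S.rel (role a) [d, z] → z ∈ (wordC w).extn S := by
  simp [wordC, ALC.extn, mem_extn_exactC]

theorem sig_wordC_subset (w : List A) : (wordC w).sig ⊆ {s | ∃ a : A, s = .rel (role a) 2} := by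
  have hex : ∀ a : A, (exactC a).sig ⊆ {s | ∃ a : A, s = .rel (role a) 2} := by
    intro a
    unfold exactC
    induction otherLetters a with
    | nil => simp [ALC.sig]
    | cons b l ih => simpa [ALC.sig, Set.insert_subset_iff] using ih
  induction w with
  | nil => simp [wordC, ALC.sig]
  | cons a w ih => simpa [wordC, ALC.sig, Set.insert_subset_iff] using ⟨hex a, ih⟩

/-- Suppose that the machine halts from the configuration `c`, and let `w` be the word that it
appends until it halts. Then in no model the machine is in the state of `c` with the read head at an
element whose paths spell the queue content of `c` followed by `w`, and the write head at an element
whose paths spell `w`: the sentences would force the heads to follow the run to its end. -/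
theorem exists_word_of_halts (hX : ∀ c, Reaches (qstep prog) (q₀, []) c → c.1 ∈ X)
    {c c' : Q × List A} (hc : Reaches (qstep prog) (q₀, []) c) (hr : Reaches (qstep prog) c c')
    (hh : prog c'.1 = .halt) : ∃ w : List A, ∀ S, (machineInput prog code q₀ X).IsModel S →
      ∀ d e, S.rel (Fintype.card A + code c.1) [d, e] → d ∈ (wordC (c.2 ++ w)).extn S →
        e ∉ (wordC w).extn S := by
  induction hr using Relation.ReflTransGen.head_induction_on with
  | refl =>
    refine ⟨[], fun S hS d e hde _ _ => ?_⟩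
    exact ((isModel_machineInput S).1 hS).2.2.1 _ (hX _ hc) hh d e hde
  | @head c₁ c₂ h12 _ ih =>
    obtain ⟨w, hw⟩ := ih (hc.tail h12)
    obtain ⟨q, l⟩ := c₁
    cases hq : prog q with
    | write a q' =>
      rw [qstep_write hq, Option.mem_some_iff] at h12
      subst h12
      refine ⟨a :: w, fun S hS d e hde hd he => ?_⟩
      rw [mem_extn_wordC_cons] at he
      obtain ⟨z, -, hz, hdz⟩ := ((isModel_machineInput S).1 hS).1 q (hX _ hc) a q' hq d e hde he.1
      exact hw S hS d z hdz (by simpa using hd) (he.2 z hz)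
    | read δ =>
      cases l with
      | nil => simp [qstep, hq] at h12
      | cons a l =>
        rw [qstep_read hq, Option.mem_some_iff] at h12
        subst h12
        refine ⟨w, fun S hS d e hde hd he => ?_⟩
        rw [List.cons_append, mem_extn_wordC_cons] at hd
        obtain ⟨z, -, hz, hze⟩ :=
          ((isModel_machineInput S).1 hS).2.1 q (hX _ hc) δ hq a d e hde hd.1.1
        exact hw S hS z e hze (hd.2 z hz) he
    | halt => simp [qstep_halt hq] at h12

variable (A) in
/-- A model in which the negative example is the start of a path that spells the word `w`: elements
are words, and an `a`-edge removes the first letter `a`. The positive example is the empty word,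
where both heads are placed in the initial state with number `i`, and which has no outgoing edges.
-/
def wordStruc (i : ℕ) (w : List A) : Struc where
  Dom := List A
  rel
    | j, [d, e] => (∃ a, role a = j ∧ d = a :: e) ∨ (j = Fintype.card A + i ∧ d = [] ∧ e = [])
    | _, _ => True
  con c := if c = 1 then w else []

theorem wordStruc_role {i : ℕ} {w : List A} {a : A} {d e : List A} :
    (wordStruc A i w).rel (role a) [d, e] ↔ d = a :: e := by
  have := role_lt a
  constructor
  · rintro (⟨b, hb, rfl⟩ | ⟨h, -⟩)
    · rw [role_injective hb]
    · omega
  · exact fun h => .inl ⟨a, rfl, h⟩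

theorem wordStruc_state {i j : ℕ} {w d e : List A} :
    (wordStruc A i w).rel (Fintype.card A + j) [d, e] ↔ j = i ∧ d = [] ∧ e = [] := by
  constructor
  · rintro (⟨b, hb, rfl⟩ | ⟨h, h'⟩)
    · have := role_lt b
      omega
    · exact ⟨by omega, h'⟩
  · exact fun h => .inr ⟨by omega, h.2⟩

theorem mem_extn_wordC_wordStruc (i : ℕ) (w u : List A) :
    u ∈ (wordC u).extn (wordStruc A i w) := by
  induction u with
  | nil => trivial
  | cons a u ih =>
    refine (mem_extn_wordC_cons _ _ _ _).2 ⟨⟨⟨u, wordStruc_role.2 rfl⟩, ?_⟩, ?_⟩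
    · rintro b hb ⟨z, hz⟩
      obtain ⟨rfl, -⟩ := List.cons.inj (wordStruc_role.1 hz)
      exact hb rfl
    · intro z hz
      obtain ⟨-, rfl⟩ := List.cons.inj (wordStruc_role.1 hz)
      exact ih

theorem isModel_wordStruc (hinj : Set.InjOn code {q | q ∈ X}) (h₀ : q₀ ∈ X) (hq₀ : prog q₀ ≠ .halt)
    (w : List A) : (machineInput prog code q₀ X).IsModel (wordStruc A (code q₀) w) := by
  have no_edge : ∀ a : A, ¬ ∃ z, (wordStruc A (code q₀) w).rel (role a) [([] : List A), z] := by
    rintro a ⟨z, hz⟩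
    simpa using wordStruc_role.1 hz
  refine (isModel_machineInput _).2 ⟨?_, ?_, ?_, ?_, trivial⟩
  · intro q _ a q' _ d e hde he
    obtain ⟨-, rfl, rfl⟩ := wordStruc_state.1 hde
    exact absurd he.1 (no_edge a)
  · intro q _ δ _ a d e hde hd
    obtain ⟨-, rfl, rfl⟩ := wordStruc_state.1 hde
    exact absurd hd (no_edge a)
  · intro q hq h d e hde
    obtain ⟨hcode, -⟩ := wordStruc_state.1 hde
    exact hq₀ (hinj hq h₀ hcode ▸ h)
  · exact wordStruc_state.2 ⟨rfl, rfl, rfl⟩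

theorem Input.NonProjSeparable.projSeparable {LS : Set Fml} {I : Input}
    (h : I.NonProjSeparable LS) : I.ProjSeparable LS := by
  obtain ⟨φ, hφ, x, hx, hs, h⟩ := h
  exact ⟨φ, hφ, x, hx, ⟨∅, by simp, by simp, by simpa using hs⟩, h⟩

theorem nonProjSeparable_of_halts {LS : Set Fml} (hLS : ContainsALC LS)
    (hinj : Set.InjOn code {q | q ∈ X}) (hX : ∀ c, Reaches (qstep prog) (q₀, []) c → c.1 ∈ X)
    (hq₀ : prog q₀ ≠ .halt) {c : Q × List A} (hr : Reaches (qstep prog) (q₀, []) c)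
    (hh : prog c.1 = .halt) : (machineInput prog code q₀ X).NonProjSeparable LS := by
  obtain ⟨w, hw⟩ := exists_word_of_halts (code := code) hX .refl hr hh
  obtain ⟨φ, hφ, x, hx, hs, hsat⟩ := hLS (.neg (wordC w))
  refine ⟨φ, hφ, x, hx, fun s h => ?_, ?_, ?_⟩
  · obtain ⟨a, rfl⟩ := sig_wordC_subset w (hs h)
    exact List.mem_map.2 ⟨a, by simp, rfl⟩
  · intro a ha S hS ν hν
    obtain rfl : a = 0 := by simpa [machineInput] using ha
    rw [hsat, hν]
    have h0 := ((isModel_machineInput S).1 hS).2.2.2.1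
    exact fun h => hw S hS _ _ h0 (by simpa using h) h
  · intro a ha h
    obtain rfl : a = 1 := by simpa [machineInput] using ha
    exact (hsat _ _).1 (h _ (isModel_wordStruc hinj (hX _ .refl) hq₀ w) (fun _ => w) rfl)
      (mem_extn_wordC_wordStruc _ w w)

/-! ### Separable machines halt -/

/-- Satisfaction only depends on the relation symbols and individual names in the formula. -/
theorem sat_congr {S : Struc} {rel : ℕ → List S.Dom → Prop} {con : ℕ → S.Dom} {φ : Fml}
    (hrel : ∀ i n, Symb.rel i n ∈ φ.sig → ∀ ds : List S.Dom, ds.length = n →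
      (rel i ds ↔ S.rel i ds))
    (hcon : ∀ c, Symb.con c ∈ φ.sig → con c = S.con c) (ν : ℕ → S.Dom) :
    φ.Sat ⟨S.Dom, rel, con⟩ ν ↔ φ.Sat S ν := by
  have hval : ∀ (ν : ℕ → S.Dom) (t : Term), (∀ c, Symb.con c ∈ t.sig → con c = S.con c) →
      t.val ⟨S.Dom, rel, con⟩ ν = t.val S ν := by
    intro ν t ht
    cases t with
    | var x => rfl
    | con c => exact ht c rfl
  induction φ generalizing ν with
  | eq s t =>
    simp only [Fml.Sat]
    rw [hval ν s fun c h => hcon c (.inl h), hval ν t fun c h => hcon c (.inr h)]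
  | rel i ts =>
    simp only [Fml.Sat]
    rw [List.map_congr_left fun t ht => hval ν t fun c h => hcon c (.inr ⟨t, ht, h⟩)]
    exact hrel i _ (.inl rfl) _ (by simp)
  | neg φ ih => exact not_congr (ih hrel hcon ν)
  | and φ ψ ih1 ih2 =>
    exact and_congr (ih1 (fun i n h => hrel i n (.inl h)) (fun c h => hcon c (.inl h)) ν)
      (ih2 (fun i n h => hrel i n (.inr h)) (fun c h => hcon c (.inr h)) ν)
  | ex x φ ih => exact exists_congr fun d => ih hrel hcon _

/-- There is a path from `d` to `e` that spells the given word, and each element of the path but the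
last has outgoing edges for a single letter only. -/
def SpellPath (S : Struc) : List A → S.Dom → S.Dom → Prop
  | [], d, e => d = e
  | a :: l, d, e => Exact S a d ∧ ∃ z, S.rel (role a) [d, z] ∧ SpellPath S l z e

theorem SpellPath.append {S : Struc} {l : List A} {a : A} {d e z : S.Dom} (h : SpellPath S l d e)
    (he : Exact S a e) (hz : S.rel (role a) [e, z]) : SpellPath S (l ++ [a]) d z := by
  induction l generalizing d with
  | nil =>
    obtain rfl : d = e := h
    exact ⟨he, z, hz, rfl⟩
  | cons b l ih =>
    obtain ⟨hd, y, hy, h⟩ := h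
    exact ⟨hd, y, hy, ih h⟩

/-- The reinterpretation of the relation symbols by the run of the machine: it is in the state `q`
with heads at `d` and `e` if it reaches `q` with a queue content that is spelled by a path from `d`
to `e`. Ternary symbols hold everywhere. The role names of the letters and the concept names are
left as they are. -/
def runRel (prog : Q → Instr Q A) (code : Q → ℕ) (q₀ : Q) (S : Struc) : ℕ → List S.Dom → Prop
  | i, [d, e] => (i < Fintype.card A ∧ S.rel i [d, e]) ∨
      ∃ c, Reaches (qstep prog) (q₀, []) c ∧ i = Fintype.card A + code c.1 ∧ SpellPath S c.2 d e
  | _, [_, _, _] => True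
  | i, ds => S.rel i ds

/-- The structure in which the relation symbols are reinterpreted by the run of the machine, and the
positive example as the negative one. -/
def runStruc (prog : Q → Instr Q A) (code : Q → ℕ) (q₀ : Q) (S : Struc) : Struc where
  Dom := S.Dom
  rel := runRel prog code q₀ S
  con c := if c = 0 then S.con 1 else S.con c

theorem runRel_of_lt {S : Struc} {i : ℕ} (hi : i < Fintype.card A) {d e : S.Dom} :
    runRel prog code q₀ S i [d, e] ↔ S.rel i [d, e] := by
  constructor
  · rintro (⟨-, h⟩ | ⟨c, -, h, -⟩)
    · exact h
    · omega
  · exact fun h => .inl ⟨hi, h⟩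

theorem runRel_state {S : Struc} {i : ℕ} {d e : S.Dom} :
    runRel prog code q₀ S (Fintype.card A + i) [d, e] ↔
      ∃ c, Reaches (qstep prog) (q₀, []) c ∧ i = code c.1 ∧ SpellPath S c.2 d e := by
  simp [runRel]

theorem exact_runStruc {S : Struc} {a : A} {d : S.Dom} :
    Exact (runStruc prog code q₀ S) a d ↔ Exact S a d := by
  simp only [Exact, runStruc, runRel_of_lt (role_lt _)]

theorem isModel_runStruc (hinj : Set.InjOn code {q | q ∈ X})
    (hX : ∀ c, Reaches (qstep prog) (q₀, []) c → c.1 ∈ X)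
    (hread : ∀ c, Reaches (qstep prog) (q₀, []) c → ∀ δ, prog c.1 = .read δ → c.2 ≠ [])
    (hhalt : ∀ c, Reaches (qstep prog) (q₀, []) c → prog c.1 ≠ .halt) (S : Struc) :
    (machineInput prog code q₀ X).IsModel (runStruc prog code q₀ S) := by
  refine (isModel_machineInput _).2 ⟨?_, ?_, ?_, ?_, trivial⟩
  · intro q hq a q' h d e hde he
    obtain ⟨⟨q₁, l⟩, hc, hcode, hl⟩ := runRel_state.1 hde
    obtain rfl : q = q₁ := hinj hq (hX _ hc) hcode
    replace he : Exact S a e := exact_runStruc.1 he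
    obtain ⟨z, hz⟩ := he.1
    exact ⟨z, trivial, (runRel_of_lt (role_lt a)).2 hz,
      runRel_state.2 ⟨_, hc.tail (qstep_write h l), rfl, hl.append he hz⟩⟩
  · rintro q hq δ h a d e hde ⟨y, hy⟩
    obtain ⟨⟨q₁, l⟩, hc, hcode, hl⟩ := runRel_state.1 hde
    obtain rfl : q = q₁ := hinj hq (hX _ hc) hcode
    replace hy := (runRel_of_lt (role_lt a)).1 hy
    cases l with
    | nil => exact absurd rfl (hread _ hc δ h)
    | cons b l =>
      obtain ⟨hd, z, hz, hl⟩ := hl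
      -- The queue content was spelled exactly, so that the letter seen is its first letter.
      obtain rfl : a = b := by
        by_contra hab
        exact hd.2 a hab ⟨y, hy⟩
      exact ⟨z, trivial, (runRel_of_lt (role_lt a)).2 hz,
        runRel_state.2 ⟨_, hc.tail (qstep_read h a l), rfl, hl⟩⟩
  · intro q hq h d e hde
    obtain ⟨⟨q₁, l⟩, hc, hcode, hl⟩ := runRel_state.1 hde
    obtain rfl : q = q₁ := hinj hq (hX _ hc) hcode
    exact hhalt _ hc h
  · exact runRel_state.2 ⟨_, .refl, rfl, rfl⟩

theorem not_projSeparable_of_not_halts {LS : Set Fml} (hinj : Set.InjOn code {q | q ∈ X})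
    (hX : ∀ c, Reaches (qstep prog) (q₀, []) c → c.1 ∈ X)
    (hread : ∀ c, Reaches (qstep prog) (q₀, []) c → ∀ δ, prog c.1 = .read δ → c.2 ≠ [])
    (hhalt : ∀ c, Reaches (qstep prog) (q₀, []) c → prog c.1 ≠ .halt) :
    ¬ (machineInput prog code q₀ X).ProjSeparable LS := by
  rintro ⟨φ, -, x, -, ⟨H, hH, -, hsig⟩, hpos, hneg⟩
  refine hneg 1 (by simp [machineInput]) fun S hS ν hν => ?_
  have h := hpos 0 (by simp [machineInput]) _ (isModel_runStruc hinj hX hread hhalt S) ν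
    (by simpa [runStruc] using hν)
  refine (sat_congr ?_ ?_ ν).1 h
  · intro i n hi ds hds
    rcases hsig hi with hi | hi
    · obtain ⟨a, -, ha⟩ := List.mem_map.1 hi
      obtain ⟨rfl, rfl⟩ := Symb.rel.inj ha
      obtain ⟨d, e, rfl⟩ := List.length_eq_two.1 hds
      exact runRel_of_lt (role_lt a)
    · obtain ⟨j, hj⟩ := hH _ hi
      obtain ⟨rfl, rfl⟩ := Symb.rel.inj hj
      obtain ⟨d, rfl⟩ := List.length_eq_one_iff.1 hds
      rfl
  · intro c hc
    rcases hsig hc with hc | hc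
    · obtain ⟨a, -, ha⟩ := List.mem_map.1 hc
      cases ha
    · obtain ⟨j, hj⟩ := hH _ hc
      cases hj

end Machine

section Simulation

open Turing Turing.PartrecToTM2

/-! ### Simulating a stack machine by a queue machine -/

/-- The statements of the stack machine that evaluates partial recursive functions. -/
abbrev StackStmt := TM2.Stmt (fun _ : K' => Γ') Λ' (Option Γ')

/-- The states of the queue machine that simulates the stack machine. The queue holds the contents
of the four stacks as blocks ended by the letter `none`, in cyclic order; the parameter `i` of a
state is the stack whose block is in front. A state also holds the statement that is left to run and
the local variable. -/
inductive QState where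
  /-- the statement is run when a full block is in front -/
  | run (s : StackStmt) (v : Option Γ') (i : K')
  /-- the rest of the front block is moved to the back of the queue -/
  | copy (s : StackStmt) (v : Option Γ') (i : K')
  /-- the letter `a` just removed is appended -/
  | put (s : StackStmt) (v : Option Γ') (i : K') (a : Γ')
  /-- the end of block marker just removed is appended -/
  | close (s : StackStmt) (v : Option Γ') (i : K')
  /-- the binary digits of `2 ^ n` are written -/
  | pre (n : ℕ)
  /-- the symbol that ends the input number is written -/
  | sep
  /-- the end of the block of stack `k` is written, and then the empty blocks of the stacks after it
  -/
  | fresh (k : K')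
  /-- the stack machine has halted -/
  | fin

namespace QState

/-- The cyclic order of the stacks. -/
def nxt : K' → K'
  | .main => .rev
  | .rev => .aux
  | .aux => .stack
  | .stack => .main

/-- The state in which a letter just removed is appended. -/
def pass (s : StackStmt) (v : Option Γ') (i : K') : Option Γ' → QState
  | none => close s v i
  | some a => put s v i a

/-- The program of the queue machine for the stack machine started at the label `l₀`. A statement
that uses a stack other than the one in front is kept, and the front block is moved to the back. A
pushed letter is appended before the block is moved, so that it ends up as the first letter.
Statements that use no stack move the front block as well, which leaves the encoded stacks
unchanged. -/
def prog (l₀ : Λ') : QState → Instr QState (Option Γ')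
  | run (.push k f s) v i =>
    if i = k then .write (some (f v)) (copy s v i) else .read (pass (.push k f s) v i)
  | run (.peek k f s) v i =>
    if i = k then .read fun c => pass s (f v c) i c else .read (pass (.peek k f s) v i)
  | run (.pop k f s) v i =>
    if i = k then .read fun c => c.elim (close s (f v none) i) fun a => copy s (f v (some a)) i
    else .read (pass (.pop k f s) v i)
  | run (.load g s) v i => .read (pass s (g v) i)
  | run (.branch p s₁ s₂) v i => .read (pass (cond (p v) s₁ s₂) v i)
  | run (.goto g) v i => .read (pass (tr (g v)) v i)
  | run .halt _ _ => .read fun _ => fin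
  | copy s v i => .read (pass s v i)
  | put s v i a => .write (some a) (copy s v i)
  | close s v i => .write none (run s v (nxt i))
  | pre 0 => .write (some .bit1) sep
  | pre (n + 1) => .write (some .bit0) (pre n)
  | sep => .write (some .cons) (fresh .main)
  | fresh .stack => .write none (run (tr l₀) none .main)
  | fresh k => .write none (fresh (nxt k))
  | fin => .halt

/-- The block of a stack. -/
def block (l : List Γ') : List (Option Γ') := l.map some ++ [none]

/-- The blocks of the stacks other than `i`. -/
def blocksAfter (S : K' → List Γ') (i : K') : List (Option Γ') :=
  block (S (nxt i)) ++ (block (S (nxt (nxt i))) ++ block (S (nxt (nxt (nxt i)))))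

/-- The content of the queue when the block of stack `i` is in front. -/
def blocks (S : K' → List Γ') (i : K') : List (Option Γ') := block (S i) ++ blocksAfter S i

theorem blocks_nxt (S : K' → List Γ') (i : K') :
    blocks S (nxt i) = blocksAfter S i ++ block (S i) := by
  cases i <;> simp [blocks, blocksAfter, nxt]

theorem blocks_nxt_update (S : K' → List Γ') (k : K') (l : List Γ') :
    blocks (Function.update S k l) (nxt k) = blocksAfter S k ++ block l := by
  cases k <;> simp [blocks, blocksAfter, nxt]

variable (l₀ : Λ')

theorem reaches₁_copy (s : StackStmt) (v : Option Γ') (i : K') (l : List Γ')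
    (r : List (Option Γ')) :
    Reaches₁ (qstep (prog l₀)) (copy s v i, block l ++ r) (run s v (nxt i), r ++ block l) := by
  induction l generalizing r with
  | nil => exact .tail (.single rfl) rfl
  | cons a l ih =>
    have h : Reaches₁ (qstep (prog l₀)) (copy s v i, block (a :: l) ++ r)
        (copy s v i, block l ++ r ++ [some a]) := .tail (.single rfl) rfl
    refine h.trans (show Reaches₁ _ _ _ from ?_)
    simpa [block] using ih (r ++ [some a])

theorem reaches₁_of_read {s : StackStmt} {v : Option Γ'} {i : K'} {q : QState}
    {δ : Option Γ' → QState} (hq : prog l₀ q = .read δ) {l : List Γ'}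
    (hδ : δ l.head? = pass s v i l.head?) (r : List (Option Γ')) :
    Reaches₁ (qstep (prog l₀)) (q, block l ++ r) (run s v (nxt i), r ++ block l) := by
  refine (reaches₁_eq ?_).1 (reaches₁_copy l₀ s v i l r)
  cases l <;> exact (qstep_read rfl _ _).trans ((qstep_read hq _ _).trans (by simp_all)).symm

theorem reaches₁_blocks_of_read {s : StackStmt} {v : Option Γ'} {i : K'} {q : QState}
    {δ : Option Γ' → QState} (hq : prog l₀ q = .read δ) {S : K' → List Γ'}
    (hδ : δ (S i).head? = pass s v i (S i).head?) :
    Reaches₁ (qstep (prog l₀)) (q, blocks S i) (run s v (nxt i), blocks S (nxt i)) := by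
  rw [blocks_nxt]
  exact reaches₁_of_read l₀ hq hδ _

/-- A statement that waits for the block of stack `k` gets to see it. -/
theorem reaches_blocks {s : StackStmt} {v : Option Γ'} {k : K'}
    (h : ∀ i, i ≠ k → prog l₀ (run s v i) = .read (pass s v i)) (S : K' → List Γ') (i : K') :
    Reaches (qstep (prog l₀)) (run s v i, blocks S i) (run s v k, blocks S k) := by
  have step : ∀ i, i = k ∨ Reaches (qstep (prog l₀)) (run s v i, blocks S i)
      (run s v (nxt i), blocks S (nxt i)) := fun i =>
    or_iff_not_imp_left.2 fun hi => (reaches₁_blocks_of_read l₀ (h i hi) rfl).to_reflTransGen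
  -- The target is met within three steps, as four steps go round the cycle of stacks.
  obtain rfl | h₁ := step i
  · exact .refl
  refine h₁.trans ?_
  obtain h' | h₂ := step (nxt i)
  · rw [h']
  refine h₂.trans ?_
  obtain h' | h₃ := step (nxt (nxt i))
  · rw [h']
  refine h₃.trans ?_
  obtain h' | h₄ := step (nxt (nxt (nxt i)))
  · rw [h']
  have : k = i ∨ k = nxt i ∨ k = nxt (nxt i) ∨ k = nxt (nxt (nxt i)) := by
    cases i <;> cases k <;> simp [nxt]
  have h4 : nxt (nxt (nxt (nxt i))) = i := by cases i <;> rfl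
  rw [h4] at h₄
  obtain rfl | rfl | rfl | rfl := this
  · exact h₄
  · exact h₄.trans h₁
  · exact h₄.trans (h₁.trans h₂)
  · exact .refl

/-- The configurations of the queue machine that stand for a configuration of the stack machine. -/
def Simulates : TM2.Cfg (fun _ : K' => Γ') Λ' (Option Γ') → QState × List (Option Γ') → Prop
  | ⟨some l, v, S⟩, c => ∃ i, c = (run (tr l) v i, blocks S i)
  | ⟨none, _, _⟩, c => c.1 = fin

theorem exists_reaches₁_run (s : StackStmt) (v : Option Γ') (S : K' → List Γ') (i : K') :
    ∃ c, Simulates (TM2.stepAux s v S) c ∧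
      Reaches₁ (qstep (prog l₀)) (run s v i, blocks S i) c := by
  induction s generalizing v S i with
  | push k f s ih =>
    obtain ⟨c, hc, h⟩ := ih v (Function.update S k (f v :: S k)) (nxt k)
    refine ⟨c, hc, Relation.TransGen.trans_right
      (reaches_blocks l₀ (k := k) (fun i hi => by simp [prog, hi]) S i) ?_⟩
    have h1 : Reaches₁ (qstep (prog l₀)) (run (.push k f s) v k, blocks S k)
        (copy s v k, blocks S k ++ [some (f v)]) := .single (qstep_write (by simp [prog]) _)
    refine h1.trans (.trans (show Reaches₁ _ _ _ from ?_) h)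
    have h2 := reaches₁_copy l₀ s v k (S k) (blocksAfter S k ++ [some (f v)])
    rw [blocks_nxt_update]
    simpa [blocks, block] using h2
  | peek k f s ih =>
    obtain ⟨c, hc, h⟩ := ih (f v (S k).head?) S (nxt k)
    refine ⟨c, hc, Relation.TransGen.trans_right
      (reaches_blocks l₀ (k := k) (fun i hi => by simp [prog, hi]) S i) (.trans ?_ h)⟩
    exact reaches₁_blocks_of_read l₀ (δ := fun c => pass s (f v c) k c) (by simp [prog]) rfl
  | pop k f s ih =>
    obtain ⟨c, hc, h⟩ := ih (f v (S k).head?) (Function.update S k (S k).tail) (nxt k)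
    refine ⟨c, hc, Relation.TransGen.trans_right
      (reaches_blocks l₀ (k := k) (fun i hi => by simp [prog, hi]) S i) (.trans ?_ h)⟩
    have hp : prog l₀ (run (.pop k f s) v k) =
        .read fun c => c.elim (close s (f v none) k) fun a => copy s (f v (some a)) k := by
      simp [prog]
    rw [blocks_nxt_update, blocks]
    cases S k with
    | nil => exact reaches₁_of_read l₀ hp rfl _
    | cons a l =>
      have h1 : Reaches₁ (qstep (prog l₀)) (run (.pop k f s) v k, block (a :: l) ++ blocksAfter S k)
          (copy s (f v (some a)) k, block l ++ blocksAfter S k) := .single (qstep_read hp _ _)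
      exact h1.trans (reaches₁_copy l₀ _ _ _ _ _)
  | load g s ih =>
    obtain ⟨c, hc, h⟩ := ih (g v) S (nxt i)
    exact ⟨c, hc, (reaches₁_blocks_of_read l₀ (by rfl) rfl).trans h⟩
  | branch p s₁ s₂ ih₁ ih₂ =>
    have h1 : Reaches₁ (qstep (prog l₀)) (run (.branch p s₁ s₂) v i, blocks S i)
        (run (cond (p v) s₁ s₂) v (nxt i), blocks S (nxt i)) :=
      reaches₁_blocks_of_read l₀ (by rfl) rfl
    rw [TM2.stepAux]
    cases hp : p v with
    | true =>
      obtain ⟨c, hc, h⟩ := ih₁ v S (nxt i)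
      rw [hp] at h1
      exact ⟨c, hc, h1.trans h⟩
    | false =>
      obtain ⟨c, hc, h⟩ := ih₂ v S (nxt i)
      rw [hp] at h1
      exact ⟨c, hc, h1.trans h⟩
  | goto g => exact ⟨_, ⟨nxt i, rfl⟩, reaches₁_blocks_of_read l₀ (by rfl) rfl⟩
  | halt =>
    have hb : ∃ a r, blocks S i = a :: r := by
      unfold blocks block
      cases S i <;> simp
    obtain ⟨a, r, hb⟩ := hb
    rw [hb]
    exact ⟨(fin, r), rfl, .single (qstep_read (δ := fun _ => fin) rfl _ _)⟩

theorem respects_simulates : Respects (TM2.step tr) (qstep (prog l₀)) Simulates := by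
  rintro ⟨_ | l, v, S⟩ ⟨q, r⟩ h
  · obtain rfl : q = fin := h
    exact qstep_halt rfl r
  · obtain ⟨i, h⟩ := h
    obtain ⟨rfl, rfl⟩ := Prod.mk.inj h
    exact exists_reaches₁_run l₀ (tr l) v S i

theorem trPosNum_iterate_bit0 (n : ℕ) :
    trPosNum (PosNum.bit0^[n] 1) = List.replicate n .bit0 ++ [.bit1] := by
  induction n with
  | zero => rfl
  | succ n ih =>
    rw [Function.iterate_succ_apply', trPosNum, ih, List.replicate_succ, List.cons_append]

theorem cast_two_pow (n : ℕ) : ((2 ^ n : ℕ) : Num) = .pos (PosNum.bit0^[n] 1) := by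
  induction n with
  | zero => rfl
  | succ n ih =>
    rw [Function.iterate_succ_apply', pow_succ, mul_two, Nat.cast_add, ih]
    exact Num.bit0_of_bit0 (.pos _)

theorem trNat_two_pow (n : ℕ) : trNat (2 ^ n) = List.replicate n .bit0 ++ [.bit1] := by
  rw [trNat, cast_two_pow]
  exact trPosNum_iterate_bit0 n

/-- The machine writes the blocks for the input `2 ^ n` and then starts the simulation. -/
theorem reaches_run_of_pre (n : ℕ) : Reaches (qstep (prog l₀)) (pre n, [])
    (run (tr l₀) none .main, blocks (K'.elim (trList [2 ^ n]) [] [] []) .main) := by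
  have hpre : ∀ n l, Reaches (qstep (prog l₀)) (pre n, l)
      (pre 0, l ++ List.replicate n (some .bit0)) := by
    intro n
    induction n with
    | zero => intro l; rw [List.replicate_zero, List.append_nil]; exact .refl
    | succ n ih =>
      intro l
      refine .head rfl ?_
      rw [List.replicate_succ, List.append_cons l (some .bit0) (List.replicate n _)]
      exact ih (l ++ [some .bit0])
  refine (hpre n []).trans
    (.head rfl (.head rfl (.head rfl (.head rfl (.head rfl (.head rfl ?_))))))
  rw [trList, trNat_two_pow]
  simpa [blocks, blocksAfter, block, nxt, trList] using Relation.ReflTransGen.refl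

/-- The end of block marker is in the queue in those states where a letter may be read before a
marker is written. -/
def HasMarker : QState × List (Option Γ') → Prop
  | (run _ _ _, l) => none ∈ l
  | (copy _ _ _, l) => none ∈ l
  | (put _ _ _ _, l) => none ∈ l
  | _ => True

theorem hasMarker_pass {s : StackStmt} {v : Option Γ'} {i : K'} {c : Option Γ'}
    {l : List (Option Γ')} (h : none ∈ c :: l) : HasMarker (pass s v i c, l) := by
  cases c with
  | none => trivial
  | some a => simpa [HasMarker, pass] using h

theorem hasMarker_step {c c' : QState × List (Option Γ')} (h : HasMarker c)
    (hc : c' ∈ qstep (prog l₀) c) : HasMarker c' := by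
  obtain ⟨q, l⟩ := c
  cases hq : prog l₀ q with
  | write a q' =>
    rw [qstep_write hq, Option.mem_some_iff] at hc
    subst hc
    revert hq
    fun_cases prog l₀ q <;> intro hq <;> simp at hq <;> obtain ⟨rfl, rfl⟩ := hq <;>
      simp_all [HasMarker]
  | read δ =>
    cases l with
    | nil => simp [qstep, hq] at hc
    | cons a l =>
      rw [qstep_read hq, Option.mem_some_iff] at hc
      subst hc
      revert hq
      fun_cases prog l₀ q <;> intro hq <;> simp at hq <;> subst hq <;>
        first
        | trivial
        | exact hasMarker_pass h
        | (cases a <;> simp_all [HasMarker])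
  | halt => simp [qstep_halt hq] at hc

theorem hasMarker_of_reaches {n : ℕ} {c : QState × List (Option Γ')}
    (hc : Reaches (qstep (prog l₀)) (pre n, []) c) : HasMarker c := by
  induction hc with
  | refl => trivial
  | tail _ h ih => exact hasMarker_step l₀ ih h

theorem ne_nil_of_read {q : QState} {l : List (Option Γ')} (h : HasMarker (q, l))
    {δ : Option Γ' → QState} (hq : prog l₀ q = .read δ) : l ≠ [] := by
  rintro rfl
  revert hq
  fun_cases prog l₀ q <;> simp_all [HasMarker]

/-- On input `2 ^ n`, the queue machine halts if and only if the stack machine does. -/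
theorem exists_reaches_halt_iff (c : ToPartrec.Code) (n : ℕ) :
    (∃ d, Reaches (qstep (prog (trNormal c .halt))) (pre n, []) d ∧
      prog (trNormal c .halt) d.1 = .halt) ↔ (c.eval [2 ^ n]).Dom := by
  set l₀ := trNormal c .halt with hl₀
  have h1 : (eval (qstep (prog l₀)) (pre n, [])).Dom ↔
      (eval (TM2.step tr) (init c [2 ^ n])).Dom := by
    rw [reaches_eval (reaches_run_of_pre l₀ n)]
    exact tr_eval_dom (respects_simulates l₀) ⟨_, rfl⟩
  rw [PartrecToTM2.tr_eval] at h1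
  refine Iff.trans ?_ (h1.trans (by simp))
  rw [Part.dom_iff_mem]
  refine exists_congr fun d => ?_
  rw [mem_eval]
  refine and_congr_right fun hd => ⟨fun h => qstep_halt h d.2, fun h => ?_⟩
  exact prog_eq_halt_of_qstep_eq_none
    (fun δ hδ => ne_nil_of_read l₀ (hasMarker_of_reaches l₀ hd) hδ) h

/-! ### Finiteness of the simulating machine -/

/-- The states of the queue machine whose statements belong to `T`, for inputs up to `2 ^ n`. -/
def states (T : Set StackStmt) (n : ℕ) : Set QState :=
  {q | match q with
    | run s _ _ => s ∈ T
    | copy s _ _ => s ∈ T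
    | put s _ _ _ => s ∈ T
    | close s _ _ => s ∈ T
    | pre j => j ≤ n
    | _ => True}

theorem finite_states {T : Set StackStmt} (hT : T.Finite) (n : ℕ) : (states T n).Finite := by
  have : Finite K' := .of_surjective (fun i : Fin 4 => ![K'.main, .rev, .aux, .stack] i) fun k => by
    cases k
    exacts [⟨0, rfl⟩, ⟨1, rfl⟩, ⟨2, rfl⟩, ⟨3, rfl⟩]
  have hfin (α : Type) [Finite α] : (T ×ˢ (Set.univ : Set α)).Finite := hT.prod Set.finite_univ
  refine Set.Finite.subset
    ((((hfin (Option Γ' × K')).image fun p => run p.1 p.2.1 p.2.2).union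
    ((hfin (Option Γ' × K')).image fun p => copy p.1 p.2.1 p.2.2)).union
    ((((hfin (Option Γ' × K' × Γ')).image fun p => put p.1 p.2.1 p.2.2.1 p.2.2.2).union
    ((hfin (Option Γ' × K')).image fun p => close p.1 p.2.1 p.2.2)).union
    ((((Set.finite_Iic n).image pre).union (Set.finite_range fresh)).union
    (Set.toFinite {sep, fin})))) ?_
  intro q hq
  cases q <;> simp_all [states]

theorem states_pass {T : Set StackStmt} {n : ℕ} {s : StackStmt} (hs : s ∈ T) (v : Option Γ')
    (i : K') (c : Option Γ') : pass s v i c ∈ states T n := by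
  cases c <;> exact hs

/-- The statements reachable from the labels in `S`. -/
def stmtsOf (S : Finset Λ') : Set StackStmt := {s | some s ∈ TM2.stmts tr S}

theorem finite_stmtsOf (S : Finset Λ') : (stmtsOf S).Finite :=
  Set.Finite.preimage (Option.some_injective _).injOn (TM2.stmts tr S).finite_toSet

theorem tr_mem_stmtsOf {S : Finset Λ'} {l : Λ'} (h : l ∈ S) : tr l ∈ stmtsOf S := by
  simp only [stmtsOf, TM2.stmts, Finset.some_mem_insertNone, Finset.mem_biUnion]
  exact ⟨l, h, TM2.stmts₁_self⟩

theorem states_closed {S : Finset Λ'} (hS : @TM2.Supports _ _ _ _ ⟨l₀⟩ tr S) {n : ℕ}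
    {c c' : QState × List (Option Γ')} (h : c.1 ∈ states (stmtsOf S) n)
    (hc : c' ∈ qstep (prog l₀) c) : c'.1 ∈ states (stmtsOf S) n := by
  have sub {s s' : StackStmt} (hs : s ∈ stmtsOf S) (h : s' ∈ TM2.stmts₁ s) : s' ∈ stmtsOf S :=
    TM2.stmts_trans h hs
  have hpush {k f s} (hs : .push k f s ∈ stmtsOf S) : s ∈ stmtsOf S :=
    sub hs (by simp [TM2.stmts₁, TM2.stmts₁_self])
  have hpeek {k f s} (hs : .peek k f s ∈ stmtsOf S) : s ∈ stmtsOf S :=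
    sub hs (by simp [TM2.stmts₁, TM2.stmts₁_self])
  have hpop {k f s} (hs : .pop k f s ∈ stmtsOf S) : s ∈ stmtsOf S :=
    sub hs (by simp [TM2.stmts₁, TM2.stmts₁_self])
  have hload {f s} (hs : .load f s ∈ stmtsOf S) : s ∈ stmtsOf S :=
    sub hs (by simp [TM2.stmts₁, TM2.stmts₁_self])
  have hbranch {p s₁ s₂} (b : Bool) (hs : .branch p s₁ s₂ ∈ stmtsOf S) :
      cond b s₁ s₂ ∈ stmtsOf S := by
    cases b <;> exact sub hs (by simp [TM2.stmts₁, TM2.stmts₁_self])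
  have hgoto {g : Option Γ' → Λ'} (v : Option Γ') (hs : .goto g ∈ stmtsOf S) :
      tr (g v) ∈ stmtsOf S := tr_mem_stmtsOf (@TM2.stmts_supportsStmt _ _ _ _ ⟨l₀⟩ _ _ _ hS hs v)
  obtain ⟨q, l⟩ := c
  cases hq : prog l₀ q with
  | write a q' =>
    rw [qstep_write hq, Option.mem_some_iff] at hc
    subst hc
    revert hq
    fun_cases prog l₀ q <;> intro hq <;> simp at hq <;> obtain ⟨rfl, rfl⟩ := hq <;>
      first
      | trivial
      | exact h
      | exact hpush h
      | exact tr_mem_stmtsOf hS.1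
      | exact Nat.le_of_succ_le h
  | read δ =>
    cases l with
    | nil => simp [qstep, hq] at hc
    | cons a l =>
      rw [qstep_read hq, Option.mem_some_iff] at hc
      subst hc
      revert hq
      fun_cases prog l₀ q <;> intro hq <;> simp at hq <;> subst hq <;>
        first
        | trivial
        | exact states_pass h _ _ _
        | exact states_pass (hpeek h) _ _ _
        | exact states_pass (hload h) _ _ _
        | exact states_pass (hbranch _ h) _ _ _
        | exact states_pass (hgoto _ h) _ _ _
        | (cases a <;> exact hpop h)
  | halt => simp [qstep_halt hq] at hc

theorem mem_states_of_reaches {S : Finset Λ'} (hS : @TM2.Supports _ _ _ _ ⟨l₀⟩ tr S) {n : ℕ}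
    {c : QState × List (Option Γ')} (hc : Reaches (qstep (prog l₀)) (pre n, []) c) :
    c.1 ∈ states (stmtsOf S) n := by
  induction hc with
  | refl => exact le_refl n
  | tail _ h ih => exact states_closed l₀ hS ih h

theorem mem_states_iff {T : Set StackStmt} {n : ℕ} {q : QState} :
    q ∈ states T n ↔ q ∈ states T 0 ∨ ∃ j < n, q = pre (j + 1) := by
  cases q with
  | pre j =>
    cases j with
    | zero => simp [states]
    | succ j => simp [states]
  | _ => simp [states]

end QState

end Simulation

/-- The elements of a finite set and of a sequence can be numbered such that the numbers of the
sequence are consecutive. -/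
theorem exists_code {α : Type} (F : Finset α) {f : ℕ → α} (hf : Function.Injective f) :
    ∃ (code : α → ℕ) (m : ℕ), (∀ j, code (f j) = m + j) ∧
      Set.InjOn code {x | x ∈ F ∨ ∃ j, x = f j} := by
  classical
  let code : α → ℕ := fun x =>
    if h : ∃ j, x = f j then F.card + h.choose
    else if h : x ∈ F then F.equivFin ⟨x, h⟩ else 0
  have code_f (j) : code (f j) = F.card + j := by
    have h : ∃ i, f j = f i := ⟨j, rfl⟩
    simp only [code, dif_pos h]
    rw [← hf h.choose_spec]
  have code_F {x} (h : ¬ ∃ j, x = f j) (hx : x ∈ F) : code x = F.equivFin ⟨x, hx⟩ := by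
    simp only [code, dif_neg h, dif_pos hx]
  refine ⟨code, F.card, code_f, fun x hx y hy hxy => ?_⟩
  by_cases h : ∃ j, x = f j <;> by_cases h' : ∃ j, y = f j
  · obtain ⟨i, rfl⟩ := h
    obtain ⟨j, rfl⟩ := h'
    rw [code_f, code_f, Nat.add_left_cancel_iff] at hxy
    rw [hxy]
  · obtain ⟨i, rfl⟩ := h
    have hy := hy.resolve_right h'
    rw [code_f, code_F h' hy] at hxy
    omega
  · obtain ⟨i, rfl⟩ := h'
    have hx := hx.resolve_right h
    rw [code_f, code_F h hx] at hxy
    omega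
  · have hx := hx.resolve_right h
    have hy := hy.resolve_right h'
    rw [code_F h hx, code_F h' hy, Fin.val_inj, EmbeddingLike.apply_eq_iff_eq] at hxy
    exact congrArg Subtype.val hxy

/-! ### Computability of the reduction -/

theorem primrec_neg : Primrec Fml.neg := by
  refine Primrec.encode_iff.1 (Primrec.of_eq
    (f := fun φ => 5 * Encodable.encode φ + 2) ?_ fun _ => rfl)
  exact Primrec.nat_add.comp (Primrec.nat_mul.comp (Primrec.const 5) Primrec.encode)
    (Primrec.const 2)

theorem primrec_and : Primrec₂ Fml.and := by
  refine Primrec.encode_iff.1 (Primrec.of_eq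
    (f := fun p : Fml × Fml => 5 * Nat.pair (Encodable.encode p.1) (Encodable.encode p.2) + 3)
    ?_ fun _ => rfl)
  exact Primrec.nat_add.comp (Primrec.nat_mul.comp (Primrec.const 5) (Primrec₂.natPair.comp
    (Primrec.encode.comp Primrec.fst) (Primrec.encode.comp Primrec.snd))) (Primrec.const 3)

theorem primrec_ex (x : ℕ) : Primrec (Fml.ex x) := by
  refine Primrec.encode_iff.1 (Primrec.of_eq
    (f := fun φ => 5 * Nat.pair x (Encodable.encode φ) + 4) ?_ fun _ => rfl)
  exact Primrec.nat_add.comp (Primrec.nat_mul.comp (Primrec.const 5) (Primrec₂.natPair.comp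
    (Primrec.const x) Primrec.encode)) (Primrec.const 4)

theorem primrec_rel (ts : List Term) : Primrec fun i => Fml.rel i ts := by
  refine Primrec.encode_iff.1 (Primrec.of_eq
    (f := fun i : ℕ => 5 * Encodable.encode (i, ts) + 1) ?_ fun _ => rfl)
  exact Primrec.nat_add.comp (Primrec.nat_mul.comp (Primrec.const 5)
    (Primrec.encode.comp (Primrec.pair Primrec.id (Primrec.const ts)))) (Primrec.const 1)

theorem primrec_imp : Primrec₂ Fml.imp :=
  primrec_neg.comp (primrec_and.comp Primrec.fst (primrec_neg.comp Primrec.snd))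

theorem primrec_all (x : ℕ) : Primrec (Fml.all x) :=
  primrec_neg.comp ((primrec_ex x).comp primrec_neg)

theorem primrec_writeF {A : Type} [Fintype A] (a : A) {f g : ℕ → ℕ} (hf : Primrec f)
    (hg : Primrec g) : Primrec fun n => writeF (f n) a (g n) := by
  have hstate {f : ℕ → ℕ} (hf : Primrec f) (x y : ℕ) : Primrec fun n => stateF A (f n) x y :=
    (primrec_rel _).comp (Primrec.nat_add.comp (Primrec.const _) hf)
  exact (primrec_all 0).comp ((primrec_all 1).comp (primrec_imp.comp (hstate hf 0 1)
    (primrec_imp.comp (Primrec.const _) ((primrec_ex 2).comp (primrec_and.comp (Primrec.const _)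
      (primrec_and.comp (Primrec.const _) (hstate hg 0 2)))))))

/-- Some program halts on the input `2 ^ n` if and only if the `n`-th program halts on `0`. Powers
of two are used because their binary digits, `n` zeros and a one, are easy to write down. -/
theorem exists_code_two_pow : ∃ c : Turing.ToPartrec.Code, ∀ n,
    (c.eval [2 ^ n]).Dom ↔ (Nat.Partrec.Code.eval (Denumerable.ofNat _ n) 0).Dom := by
  let g : ℕ →. ℕ := fun x => (Nat.rfind fun m => Part.some (decide (2 ^ m = x))).bind
    fun m => Nat.Partrec.Code.eval (Denumerable.ofNat _ m) 0
  have hpow : Primrec fun m : ℕ => 2 ^ m :=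
    (Primrec.nat_rec₁ 1 (Primrec.nat_mul.comp Primrec.snd (Primrec.const 2)).to₂).of_eq fun m => by
      induction m with
      | zero => rfl
      | succ m ih => simpa [pow_succ] using ih
  have hg : Partrec g := by
    refine Partrec.bind (Partrec.rfind ?_) ?_
    · have h : Primrec fun p : ℕ × ℕ => decide (2 ^ p.2 = p.1) :=
        (Primrec.eq (α := ℕ)).decide.comp (hpow.comp Primrec.snd) Primrec.fst
      exact h.to_comp.partrec
    · exact (Nat.Partrec.Code.eval_part.comp ((Computable.ofNat _).comp Computable.snd)
        (Computable.const 0) : Partrec fun p : ℕ × ℕ =>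
          Nat.Partrec.Code.eval (Denumerable.ofNat _ p.2) 0)
  obtain ⟨c, hc⟩ := Turing.ToPartrec.Code.exists_code (Nat.Partrec'.part_iff₁.2 hg)
  refine ⟨c, fun n => ?_⟩
  have hn : n ∈ Nat.rfind fun m => Part.some (decide (2 ^ m = 2 ^ n)) := by
    refine Nat.mem_rfind.2 ⟨by simp, fun {m} hm => ?_⟩
    simpa using hm.ne
  have hgn : g (2 ^ n) = Nat.Partrec.Code.eval (Denumerable.ofNat _ n) 0 := by
    simp only [g]
    rw [Part.eq_some_iff.2 hn, Part.bind_some]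
  have h : c.eval [2 ^ n] = pure <$> g (2 ^ n) := hc ⟨[2 ^ n], rfl⟩
  rw [h, hgn]
  simp

/-- The halting problem reduces to separability. The sentences for the simulation are the same for all
inputs; only the number of sentences that write a zero, and the number of the initial state, depend
on `n`. -/
theorem exists_reduction : ∃ I : ℕ → Input, Computable I ∧
    (∀ n, ∀ L : Set Fml, GF3 ⊆ L → (I n).IsLabeledKB L) ∧
    ∀ n, ∀ LS : Set Fml, ContainsALC LS →
      ((I n).NonProjSeparable LS ↔ (Nat.Partrec.Code.eval (Denumerable.ofNat _ n) 0).Dom) ∧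
      ((I n).ProjSeparable LS ↔ (Nat.Partrec.Code.eval (Denumerable.ofNat _ n) 0).Dom) := by
  classical
  obtain ⟨c, hc⟩ := exists_code_two_pow
  let l₀ := Turing.PartrecToTM2.trNormal c .halt
  let S := Turing.PartrecToTM2.codeSupp c .halt
  have hS : @Turing.TM2.Supports _ _ _ _ ⟨l₀⟩ Turing.PartrecToTM2.tr S :=
    Turing.PartrecToTM2.tr_supports c .halt
  let F := (QState.finite_states (QState.finite_stmtsOf S) 0).toFinset
  obtain ⟨code, m, hpre, hinj⟩ := exists_code F (f := QState.pre) fun i j h => by simpa using h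
  let X (n : ℕ) : List QState := (List.range n).map (fun j => .pre (j + 1)) ++ F.toList
  have mem_X {n : ℕ} {q : QState} : q ∈ X n ↔ q ∈ QState.states (QState.stmtsOf S) n := by
    rw [QState.mem_states_iff, or_comm]
    simp [X, F, eq_comm]
  have hinjX (n : ℕ) : Set.InjOn code {q | q ∈ X n} := by
    refine hinj.mono fun q hq => ?_
    rcases List.mem_append.1 hq with hq | hq
    · obtain ⟨j, -, rfl⟩ := List.mem_map.1 hq
      exact .inr ⟨_, rfl⟩
    · exact .inl (Finset.mem_toList.1 hq)
  have hX (n : ℕ) (d) (hd : Reaches (qstep (QState.prog l₀)) (.pre n, []) d) : d.1 ∈ X n :=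
    mem_X.2 (QState.mem_states_of_reaches l₀ hS hd)
  let I (n : ℕ) : Input := machineInput (QState.prog l₀) code (.pre n) (X n)
  have hI : Primrec I := by
    have hont : Primrec fun n => (I n).ont := by
      have h : ∀ n, (I n).ont = (List.range n).map
          (fun j => writeF (m + (j + 1)) (some Turing.PartrecToTM2.Γ'.bit0) (m + j)) ++
          F.toList.flatMap fun q => instrF code q (QState.prog l₀ q) := by
        intro n
        have h' (j : ℕ) : instrF code (.pre (j + 1)) (QState.prog l₀ (.pre (j + 1))) =
            [writeF (m + (j + 1)) (some Turing.PartrecToTM2.Γ'.bit0) (m + j)] := by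
          rw [QState.prog, instrF, hpre, hpre]
        simp only [I, machineInput, X, List.flatMap_append, List.flatMap_map, h']
        rw [← List.map_eq_flatMap]
      refine (Primrec.list_append.comp (Primrec.list_map Primrec.list_range ?_)
        (Primrec.const _)).of_eq fun n => (h n).symm
      exact (primrec_writeF _ (Primrec.nat_add.comp (Primrec.const m) Primrec.succ)
        (Primrec.nat_add.comp (Primrec.const m) Primrec.id)).comp Primrec.snd
    have hdb : Primrec fun n => (I n).db := by
      refine (Primrec.list_cons.comp ((Primrec.nat_add.comp
        (Primrec.const (Fintype.card (Option Turing.PartrecToTM2.Γ')))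
        (Primrec.nat_add.comp (Primrec.const m) Primrec.id)).pair (Primrec.const [0, 0]))
        (Primrec.const [(0, [1, 1, 1])])).of_eq fun n => ?_
      simp only [I, machineInput, hpre]
      rfl
    exact (Primrec.of_equiv_symm (e := Input.equivProd)).comp
      (g := fun n => ((I n).ont, (I n).db, (I n).pos, (I n).neg, (I n).sgn))
      (hont.pair (hdb.pair (Primrec.const ([0], [1], (I 0).sgn))))
  refine ⟨I, hI.to_comp, fun n L hL => ?_, fun n LS hLS => ?_⟩
  · exact isLabeledKB_machineInput hL ⟨.pre 0, mem_X.2 (Nat.zero_le n), _, _, rfl⟩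
  · rw [← hc n, ← QState.exists_reaches_halt_iff]
    have h1 : (∃ d, Reaches (qstep (QState.prog l₀)) (.pre n, []) d ∧ QState.prog l₀ d.1 = .halt) →
        (I n).NonProjSeparable LS := by
      rintro ⟨d, hd, hh⟩
      exact nonProjSeparable_of_halts hLS (hinjX n) (hX n) (by cases n <;> simp [QState.prog]) hd hh
    have h2 : (I n).ProjSeparable LS →
        ∃ d, Reaches (qstep (QState.prog l₀)) (.pre n, []) d ∧ QState.prog l₀ d.1 = .halt := by
      contrapose!
      exact not_projSeparable_of_not_halts (hinjX n) (hX n) fun d hd δ hδ =>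
        QState.ne_nil_of_read l₀ (QState.hasMarker_of_reaches l₀ hd) hδ
    exact ⟨⟨fun h => h2 h.projSeparable, h1⟩, ⟨h2, fun h => (h1 h).projSeparable⟩⟩

/-- A problem to which the halting problem reduces by admissible inputs is undecidable. -/
theorem not_decidableOn_of_halting {α : Type} [Primcodable α] {adm P : α → Prop} {I : ℕ → α}
    (hI : Computable I) (hadm : ∀ n, adm (I n))
    (hP : ∀ n, P (I n) ↔ (Nat.Partrec.Code.eval (Denumerable.ofNat _ n) 0).Dom) :
    ¬ DecidableOn adm P := by
  rintro ⟨f, hf, h⟩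
  choose b hb hbP using fun n => h (I n) (hadm n)
  have hcomp : Computable b := (hf.comp hI).of_eq fun n => Part.eq_some_iff.2 (hb n)
  refine ComputablePred.halting_problem 0 (ComputablePred.computable_iff.2
    ⟨fun c => b (Encodable.encode c), hcomp.comp Computable.encode, ?_⟩)
  funext c
  rw [hbP, hP, Denumerable.ofNat_encode]

end GFSep

theorem mainTheorem8 (L LS : Set GFSep.Fml) (hL : GFSep.GF3 ⊆ L) (hLS : GFSep.ContainsALC LS) :
    ¬ GFSep.ProjSeparabilityDecidable L LS ∧ ¬ GFSep.NonProjSeparabilityDecidable L LS := by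
  obtain ⟨I, hI, hadm, h⟩ := GFSep.exists_reduction
  exact ⟨GFSep.not_decidableOn_of_halting hI (fun n => hadm n L hL) fun n => (h n LS hLS).2,
    GFSep.not_decidableOn_of_halting hI (fun n => hadm n L hL) fun n => (h n LS hLS).1⟩
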